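/- **Threads.** For $0<a\le 1$ put $d_{1,a}(x,y)=\min\{|x-y|,\ x+(1-y)+a,\ y+(1-x)+a\}$ on $[0,1]$. Fix an enumeration $(q_n)_{n\ge 1}$ (without repetition) of $\mathbb{Q}\cap(0,1)$, and let $\Delta$ be the set of decreasing sequences $\gamma=(\gamma_i)_{i\ge1}$ with $0<\gamma_i<2^{-(i+1)}$ for all $i$ and $q_1+\gamma_1<1$. For $\gamma\in\Delta$ define inductively $G_i^\gamma=(q_{n_i},q_{n_i}+\gamma_i)$, where $n_i$ is the least $n$ with $(q_n,q_n+\gamma_i)\subset(0,1)\setminus\bigcup_{j<i}G_j^\gamma$ (so $n_1=1$), and let $T_\gamma=[0,1]\setminus\bigcup_iG_i^\gamma$. Write $T_\gamma(1,a)$ for $T_\gamma$ with the metric $d_{1,a}$. For two points $A,B$ at distance $a\in(0,1]$, the *threading space* $\mathrm{Th}(A,B)$ is the disjoint union of all $T_\gamma(1,a)$, $\gamma\in\Delta$, with all the points $0$ identified to $A$ and all the points $1$ identified to $B$; points $x,y$ of the same thread keep their distance, and points of different threads have distance $\min\{d(x,A)+d(A,y),\,d(x,B)+d(B,y)\}$.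 **Skein spaces.** Define an increasing family of complete metric spaces $\mathrm{Sk}(\beta)$, $\beta$ an ordinal, by transfinite recursion. $\mathrm{Sk}(0)$ consists of two points at distance $1/2$. For $\lambda$ an ordinal let $G_\lambda=\mathrm{Sk}(\lambda)\setminus\bigcup_{\alpha<\lambda}\mathrm{Sk}(\alpha)$. Then $\mathrm{Sk}(\lambda+1)$ is obtained from $\mathrm{Sk}(\lambda)$ by attaching, for each unordered pair $\{p,q\}$ with $p\in\mathrm{Sk}(\lambda)$, $q\in G_\lambda$, $0<d(p,q)\le1/2$, a separate copy of a threading space along its two anchors, which are identified with $p$ and $q$ (in an arbitrarily chosen order). The distances within $\mathrm{Sk}(\lambda)$ and within each threading space are kept; a non-anchor point $x$ of the threading space attached at $\{p,q\}$ and a point $y\in\mathrm{Sk}(\lambda)$ have distance $\min_{u\in\{p,q\}}\big(d(x,u)+d(u,y)\big)$; non-anchor points $x,y$ of the threading spaces attached at different pairs $\{p,q\}\ne\{p',q'\}$ have distance $\min\{d(x,u)+d(u,v)+d(v,y): u\in\{p,q\},\ v\in\{p',q'\}\}$. For a limit ordinal $\kappa$, $\mathrm{Sk}(\kappa)$ is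 the completion of $\bigcup_{\alpha<\kappa}\mathrm{Sk}(\alpha)$. For $\beta\le\omega_1$ the space $\mathrm{Sk}(\beta)$ is thus a subspace of $\mathrm{Sk}(\omega_1)$. **Statement.** Let $\beta<\omega_1$ and let $B=\{p\in\mathrm{Sk}(\omega_1): d(p,\mathrm{Sk}(\beta))<1/8\}$. Then: 1. Every $p\in B$ has exactly one nearest point in $\mathrm{Sk}(\beta)$, that is, there is exactly one point $P_\beta(p)\in\mathrm{Sk}(\beta)$ with $d(p,P_\beta(p))=d(p,\mathrm{Sk}(\beta))$. 2. If $p,q\in B$ and $P_\beta(p)\neq P_\beta(q)$, then $d(p,q)=d(p,P_\beta(p))+d(P_\beta(p),P_\beta(q))+d(P_\beta(q),q)$. 3. The map $P_\beta\colon B\to\mathrm{Sk}(\beta)$ is $1$-Lipschitz and is the identity on $\mathrm{Sk}(\beta)$ (so $B$ is $\beta$-stable). In particular, $\mathrm{Sk}(\beta)$ is a $1$-Lipschitz retract of $B$. -/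

import Mathlib

open Set Filter Topology

open scoped Ordinal

noncomputable section

namespace Skein

/-! ### Threads -/

/-- The thread metric of length `l` and width `a` on (subsets of) `[0, l]`. -/
def threadDist (l a x y : ℝ) : ℝ :=
  min |x - y| (min (x + (l - y) + a) (y + (l - x) + a))

/-- An ordering `(q_n)` of the rational numbers of `(0, 1)`. Indices start at `0` here. -/
abbrev RatEnum : Type := ℕ ≃ {r : ℚ // 0 < r ∧ r < 1}

/-- The family `Δ` of gap sequences. Indices start at `0`, so that `γ i` is the length of the
`(i + 1)`-st gap and is required to be smaller than `2 ^ (-(i + 2))`. -/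
def gapSeqs (e : RatEnum) : Set (ℕ → ℝ) :=
  {γ | Antitone γ ∧ (∀ i, 0 < γ i) ∧ (∀ i, γ i < (1 / 2 : ℝ) ^ (i + 2)) ∧
    ((e 0 : ℚ) : ℝ) + γ 0 < 1}

/-- `gapIndex e γ i` is the least `n` such that `(q_n, q_n + γ i)` is contained in `(0, 1)` and
disjoint from the gaps chosen before step `i`. For `γ ∈ gapSeqs e` such an `n` always exists, and
it is `0` for `i = 0`. -/
def gapIndex (e : RatEnum) (γ : ℕ → ℝ) (i : ℕ) : ℕ :=
  sInf {n : ℕ | Ioo ((e n : ℚ) : ℝ) ((e n : ℚ) + γ i) ⊆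
    Ioo 0 1 \ ⋃ j : Fin i,
      Ioo ((e (gapIndex e γ j) : ℚ) : ℝ) ((e (gapIndex e γ j) : ℚ) + γ j)}
termination_by i
decreasing_by exact j.2

/-- The `i`-th gap. -/
def gap (e : RatEnum) (γ : ℕ → ℝ) (i : ℕ) : Set ℝ :=
  Ioo ((e (gapIndex e γ i) : ℚ) : ℝ) ((e (gapIndex e γ i) : ℚ) + γ i)

/-- The underlying set `T_γ ⊆ [0, 1]` of the threads attached to `γ`; the thread `T_γ(1, a)` is
this set with the metric `threadDist 1 a`. -/
def threadSet (e : RatEnum) (γ : ℕ → ℝ) : Set ℝ :=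
  Icc 0 1 \ ⋃ i, gap e γ i

/-- The distance in a threading space of width `a` between the point of parameter `t` of the
thread `T_γ(1, a)` and the point of parameter `t'` of the thread `T_γ'(1, a)`: all threads are
glued together at their common extreme points `0` and `1`. -/
def threadingDist (a : ℝ) (γ γ' : ℕ → ℝ) (t t' : ℝ) : ℝ :=
  open Classical in
  if γ = γ' then threadDist 1 a t t'
  else min (threadDist 1 a t 0 + threadDist 1 a 0 t') (threadDist 1 a t 1 + threadDist 1 a 1 t')

/-! ### Labels for the points of the skein spaces

The skein spaces form an increasing family of metric spaces. To make the inclusions literal, all of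
them are realized inside one fixed set of labels. -/

/-- Labels: the two points of the first skein; the point of parameter `t` on the thread `T_γ(p, q)`
going from `p` (parameter `0`) to `q` (parameter `1`); the ideal limit of a Cauchy sequence. -/
inductive Pt : Type
  | base (b : Bool)
  | thread (p q : Pt) (γ : ℕ → ℝ) (t : ℝ)
  | lim (s : ℕ → Pt)

/-- For every unordered pair, a choice of which of its points is the anchor of parameter `0` and
which one is the anchor of parameter `1` (the choice of the isometry from the anchors of a
threading space onto the pair at which it is attached). -/
structure Orientation where
  /-- The chosen ordering of the pair. -/
  toFun : Sym2 Pt → Pt × Pt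
  spec : ∀ z, s((toFun z).1, (toFun z).2) = z

/-- A stage of the construction: the set `carrier` of points of the current skein, the set `old`
of those points that belong to some previous skein, and the distance (relevant on `carrier`
only). -/
structure Stage where
  /-- The union of the previous skeins. -/
  old : Set Pt
  /-- The points of the skein. -/
  carrier : Set Pt
  /-- The distance of the skein. -/
  dist : Pt → Pt → ℝ

namespace Stage

open Classical in
/-- The `0`-skein: two points at distance `1 / 2`. -/
def zero : Stage where
  old := ∅
  carrier := range Pt.base
  dist x y := if x = y then 0 else 1 / 2

/-! ### Successor step: attaching threading spaces -/

/-- The set `Γ` of unordered pairs at which threading spaces are attached: pairs of distinct points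
at distance at most `1 / 2`, at least one of which lies in the newest generation. -/
def pairs (X : Stage) : Set (Sym2 Pt) :=
  {z | ∃ p ∈ X.carrier, ∃ q ∈ X.carrier \ X.old,
    z = s(p, q) ∧ 0 < X.dist p q ∧ X.dist p q ≤ 1 / 2}

/-- The points that are added: for each pair in `Γ`, all points of the threading space anchored at
this pair, except for the two anchors themselves. (When `X` is a skein these labels are not in
`X.carrier`, see `newPts_disjoint` below.) -/
def newPts (e : RatEnum) (o : Orientation) (X : Stage) : Set Pt :=
  {x | ∃ z ∈ X.pairs, ∃ γ ∈ gapSeqs e, ∃ t ∈ threadSet e γ, t ≠ 0 ∧ t ≠ 1 ∧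
    x = Pt.thread (o.toFun z).1 (o.toFun z).2 γ t}

/-- Minimum over the two anchors. -/
def min2 (f : Bool → ℝ) : ℝ := min (f false) (f true)

/-- The two anchors of the threading space of a new point. -/
def foot : Pt → Bool → Pt
  | Pt.thread p q _ _, b => if b then q else p
  | x, _ => x

/-- The distance, in its threading space, from a new point to the two anchors. -/
def leg (X : Stage) : Pt → Bool → ℝ
  | Pt.thread p q _ t, b => threadDist 1 (X.dist p q) t (if b then 1 else 0)
  | _, _ => 0

open Classical in
/-- The distance between two new points: the distance of the threading space if they belong to the
same one, and otherwise the length of a shortest path through the anchors. -/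
def newDist (X : Stage) : Pt → Pt → ℝ
  | Pt.thread p q γ t, Pt.thread p' q' γ' t' =>
    if p = p' ∧ q = q' then threadingDist (X.dist p q) γ γ' t t'
    else min2 fun b => min2 fun b' =>
      X.leg (Pt.thread p q γ t) b +
        X.dist (foot (Pt.thread p q γ t) b) (foot (Pt.thread p' q' γ' t') b') +
        X.leg (Pt.thread p' q' γ' t') b'
  | _, _ => 0

open Classical in
/-- The distance of the attachment. -/
def attachDist (X : Stage) (x y : Pt) : ℝ :=
  if x ∈ X.carrier then
    if y ∈ X.carrier then X.dist x y
    else min2 fun b => X.leg y b + X.dist (foot y b) x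
  else
    if y ∈ X.carrier then min2 fun b => X.leg x b + X.dist (foot x b) y
    else X.newDist x y

/-- The successor step: a threading space is attached at every pair in `Γ`. -/
def succ (e : RatEnum) (o : Orientation) (X : Stage) : Stage where
  old := X.carrier
  carrier := X.carrier ∪ X.newPts e o
  dist := X.attachDist

/-! ### Limit step: completion of the union -/

open Classical in
/-- The space generated by an increasing family: the union, where the distance of two points is
computed at the first stage that contains both. -/
def union {ι : Type*} [LinearOrder ι] [WellFoundedLT ι] (F : ι → Stage) : Stage where
  old := ⋃ i, (F i).carrier
  carrier := ⋃ i, (F i).carrier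
  dist x y :=
    if h : {i | x ∈ (F i).carrier ∧ y ∈ (F i).carrier}.Nonempty then
      (F ((wellFounded_lt (α := ι)).min _ h)).dist x y
    else 0

/-- Cauchy sequences without limit. -/
structure IsFreeCauchy (X : Stage) (s : ℕ → Pt) : Prop where
  mem : ∀ n, s n ∈ X.carrier
  cauchy : ∀ ε > 0, ∃ N, ∀ m ≥ N, ∀ n ≥ N, X.dist (s m) (s n) < ε
  free : ¬ ∃ x ∈ X.carrier, Tendsto (fun n => X.dist (s n) x) atTop (𝓝 0)

/-- One representative of each class of Cauchy sequences without limit, where two sequences are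
equivalent if their distance tends to zero. -/
def limitReps (X : Stage) : Set (ℕ → Pt) :=
  range fun c : Quot (fun s t : {s : ℕ → Pt // X.IsFreeCauchy s} =>
    Tendsto (fun n => X.dist (s.1 n) (t.1 n)) atTop (𝓝 0)) => c.out.1

open Classical in
/-- A sequence of points of `X` which represents a point of the completion. -/
def approx (X : Stage) (x : Pt) : ℕ → Pt :=
  if x ∈ X.carrier then fun _ => x
  else match x with
    | Pt.lim s => s
    | x => fun _ => x

/-- The completion: one point is added for each class of Cauchy sequences without limit, and the
distance is extended by continuity. -/
def completion (X : Stage) : Stage where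
  old := X.carrier
  carrier := X.carrier ∪ Pt.lim '' X.limitReps
  dist x y := limUnder atTop fun n => X.dist (X.approx x n) (X.approx y n)

end Stage

/-- The skein spaces, by transfinite recursion. -/
def stage (e : RatEnum) (o : Orientation) (β : Ordinal.{0}) : Stage :=
  Ordinal.limitRecOn (motive := fun _ => Stage) β
    Stage.zero
    (fun _ X => X.succ e o)
    (fun κ _ F => (Stage.union fun α : Iio κ => F α.1 α.2).completion)

theorem stage_zero (e : RatEnum) (o : Orientation) : stage e o 0 = Stage.zero := by
  simp [stage]

theorem stage_add_one (e : RatEnum) (o : Orientation) (β : Ordinal.{0}) :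
    stage e o (β + 1) = (stage e o β).succ e o := by
  simp [stage]

theorem stage_limit (e : RatEnum) (o : Orientation) {κ : Ordinal.{0}}
    (hκ : Order.IsSuccLimit κ) :
    stage e o κ = (Stage.union fun α : Iio κ => stage e o α.1).completion := by
  rw [stage, Ordinal.limitRecOn_limit _ _ _ _ hκ]
  rfl

/-! ### Every stage is a metric space, and each stage extends the previous ones -/

namespace Stage

/-- `dist` is a metric on `carrier`. -/
structure IsMetric (X : Stage) : Prop where
  self : ∀ x ∈ X.carrier, X.dist x x = 0
  comm : ∀ x ∈ X.carrier, ∀ y ∈ X.carrier, X.dist x y = X.dist y x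
  tri : ∀ x ∈ X.carrier, ∀ y ∈ X.carrier, ∀ z ∈ X.carrier,
    X.dist x z ≤ X.dist x y + X.dist y z
  eq_of : ∀ x ∈ X.carrier, ∀ y ∈ X.carrier, X.dist x y = 0 → x = y

/-- `Y` contains `X` isometrically. -/
structure Extends (X Y : Stage) : Prop where
  sub : X.carrier ⊆ Y.carrier
  dist_eq : ∀ x ∈ X.carrier, ∀ y ∈ X.carrier, Y.dist x y = X.dist x y

theorem Extends.rfl {X : Stage} : Extends X X := ⟨subset_rfl, fun _ _ _ _ => Eq.refl _⟩

theorem Extends.trans {X Y Z : Stage} (h : Extends X Y) (h' : Extends Y Z) : Extends X Z :=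
  ⟨h.sub.trans h'.sub, fun x hx y hy => by
    rw [h'.dist_eq x (h.sub hx) y (h.sub hy), h.dist_eq x hx y hy]⟩

theorem IsMetric.nonneg {X : Stage} (h : X.IsMetric) {x y : Pt} (hx : x ∈ X.carrier)
    (hy : y ∈ X.carrier) : 0 ≤ X.dist x y := by
  have h1 := h.tri x hx y hy x hx
  rw [h.self x hx, h.comm y hy x hx] at h1
  linarith

theorem zero_isMetric : zero.IsMetric := by
  refine ⟨?_, ?_, ?_, ?_⟩
  · intro x _
    simp [zero]
  · intro x _ y _
    by_cases h : x = y
    · rw [h]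
    · simp [zero, h, Ne.symm h]
  · intro x _ y _ z _
    simp only [zero]
    split_ifs with h1 h2 h3 h3 h2 h3 h3 <;> try norm_num
    exact h1 (h2.trans h3)
  · intro x _ y _ h
    by_contra hne
    simp [zero, hne] at h

theorem min2_le (f : Bool → ℝ) (b : Bool) : min2 f ≤ f b := by
  cases b
  · exact min_le_left _ _
  · exact min_le_right _ _

theorem exists_min2 (f : Bool → ℝ) : ∃ b, min2 f = f b := by
  rcases min_choice (f false) (f true) with h | h
  · exact ⟨false, h⟩
  · exact ⟨true, h⟩


theorem threadDist_comm (l a x y : ℝ) : threadDist l a x y = threadDist l a y x := by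
  simp only [threadDist]
  rw [abs_sub_comm, min_comm (x + (l - y) + a)]

theorem threadDist_self {a x : ℝ} (ha : 0 ≤ a) : threadDist 1 a x x = 0 := by
  simp only [threadDist, sub_self, abs_zero]
  apply min_eq_left
  apply le_min <;> linarith

theorem threadDist_zero_one {a : ℝ} (ha1 : a ≤ 1) : threadDist 1 a 0 1 = a := by
  simp only [threadDist]
  norm_num
  exact ha1

theorem threadDist_tri {a x y z : ℝ} (ha : 0 ≤ a)
    (hx : x ∈ Icc (0 : ℝ) 1) (hy : y ∈ Icc (0 : ℝ) 1) (hz : z ∈ Icc (0 : ℝ) 1) :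
    threadDist 1 a x z ≤ threadDist 1 a x y + threadDist 1 a y z := by
  obtain ⟨hx0, hx1⟩ := hx
  obtain ⟨hy0, hy1⟩ := hy
  obtain ⟨hz0, hz1⟩ := hz
  have h1 : threadDist 1 a x z ≤ |x - z| := min_le_left _ _
  have h2 : threadDist 1 a x z ≤ x + (1 - z) + a := (min_le_right _ _).trans (min_le_left _ _)
  have h3 : threadDist 1 a x z ≤ z + (1 - x) + a := (min_le_right _ _).trans (min_le_right _ _)
  have h4 := abs_sub_le x y z
  have h5 := le_abs_self (x - y)
  have h6 := neg_abs_le (x - y)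
  have h7 := le_abs_self (y - z)
  have h8 := neg_abs_le (y - z)
  have h9 : |x - z| ≤ x + z := abs_le.2 ⟨by linarith, by linarith⟩
  have h10 : |x - z| ≤ (1 - x) + (1 - z) := abs_le.2 ⟨by linarith, by linarith⟩
  generalize threadDist 1 a x z = D at *
  simp only [threadDist]
  rcases min_choice |x - y| (min (x + (1 - y) + a) (y + (1 - x) + a)) with e | e <;> rw [e] <;>
  rcases min_choice |y - z| (min (y + (1 - z) + a) (z + (1 - y) + a)) with e' | e' <;> rw [e'] <;>
  rcases min_choice (x + (1 - y) + a) (y + (1 - x) + a) with e2 | e2 <;>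
  rcases min_choice (y + (1 - z) + a) (z + (1 - y) + a) with e3 | e3 <;>
  (try rw [e2]) <;> (try rw [e3]) <;> linarith

theorem threadDist_pos {a x y : ℝ} (ha : 0 < a)
    (hx : x ∈ Icc (0 : ℝ) 1) (hy : y ∈ Icc (0 : ℝ) 1) (hxy : x ≠ y) :
    0 < threadDist 1 a x y := by
  obtain ⟨hx0, hx1⟩ := hx
  obtain ⟨hy0, hy1⟩ := hy
  exact lt_min (abs_pos.2 (sub_ne_zero.2 hxy)) (lt_min (by linarith) (by linarith))

/-- The parameter of an anchor. -/
def par (b : Bool) : ℝ := if b then 1 else 0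

theorem par_mem (b : Bool) : par b ∈ Icc (0 : ℝ) 1 := by
  cases b <;> simp [par]

/-- What is needed about the labels of a successor stage. -/
def IsNew (X : Stage) (x : Pt) : Prop :=
  ∃ p q γ t, x = Pt.thread p q γ t ∧ p ∈ X.carrier ∧ q ∈ X.carrier ∧ 0 < X.dist p q ∧
    X.dist p q ≤ 1 ∧ t ∈ Icc (0 : ℝ) 1 ∧ t ≠ 0 ∧ t ≠ 1

theorem isNew_of_mem {X : Stage} (hX : X.IsMetric) {e : RatEnum} {o : Orientation} {x : Pt}
    (hx : x ∈ X.newPts e o) : X.IsNew x := by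
  obtain ⟨z, ⟨p, hp, q, hq, hz, hpos, hle⟩, γ, -, t, ht, h0, h1, rfl⟩ := hx
  have hs := o.spec z
  rw [hz, Sym2.eq_iff] at hs
  refine ⟨_, _, γ, t, rfl, ?_⟩
  rw [hz]
  rcases hs with ⟨ha, hb⟩ | ⟨ha, hb⟩ <;> rw [ha, hb]
  · exact ⟨hp, hq.1, hpos, by linarith, ht.1, h0, h1⟩
  · rw [hX.comm q hq.1 p hp]
    exact ⟨hq.1, hp, hpos, by linarith, ht.1, h0, h1⟩

open Classical in
/-- `foot`, extended to old points. -/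
def ufoot (X : Stage) (x : Pt) (b : Bool) : Pt := if x ∈ X.carrier then x else foot x b

open Classical in
/-- `leg`, extended to old points. -/
def uleg (X : Stage) (x : Pt) (b : Bool) : ℝ := if x ∈ X.carrier then 0 else X.leg x b

/-- The length of a shortest path through anchors. -/
def through (X : Stage) (x y : Pt) : ℝ :=
  min2 fun b => min2 fun b' => X.uleg x b + X.dist (X.ufoot x b) (X.ufoot y b') + X.uleg y b'

theorem through_le (X : Stage) (x y : Pt) (b b' : Bool) :
    X.through x y ≤ X.uleg x b + X.dist (X.ufoot x b) (X.ufoot y b') + X.uleg y b' :=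
  (min2_le _ b).trans (min2_le _ b')

theorem exists_through (X : Stage) (x y : Pt) :
    ∃ b b', X.through x y =
      X.uleg x b + X.dist (X.ufoot x b) (X.ufoot y b') + X.uleg y b' := by
  obtain ⟨b, hb⟩ := exists_min2 fun b => min2 fun b' =>
    X.uleg x b + X.dist (X.ufoot x b) (X.ufoot y b') + X.uleg y b'
  obtain ⟨b', hb'⟩ := exists_min2 fun b' =>
    X.uleg x b + X.dist (X.ufoot x b) (X.ufoot y b') + X.uleg y b'
  exact ⟨b, b', hb.trans hb'⟩

/-- An old point or a new one. -/
def Valid (X : Stage) (x : Pt) : Prop := x ∈ X.carrier ∨ x ∉ X.carrier ∧ X.IsNew x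

theorem valid_of_mem {X : Stage} (hX : X.IsMetric) {e : RatEnum} {o : Orientation} {x : Pt}
    (hx : x ∈ (X.succ e o).carrier) : X.Valid x := by
  by_cases h : x ∈ X.carrier
  · exact Or.inl h
  · exact Or.inr ⟨h, isNew_of_mem hX (hx.resolve_left h)⟩

theorem ufoot_mem {X : Stage} {x : Pt} (hx : X.Valid x) (b : Bool) : X.ufoot x b ∈ X.carrier := by
  rcases hx with h | ⟨h, p, q, γ, t, rfl, hp, hq, -⟩
  · simp [ufoot, h]
  · cases b <;> simpa [ufoot, h, foot]

theorem uleg_nonneg {X : Stage} {x : Pt} (hx : X.Valid x) (b : Bool) : 0 ≤ X.uleg x b := by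
  rcases hx with h | ⟨h, p, q, γ, t, rfl, hp, hq, ha, -, ht, h0, h1⟩
  · simp [uleg, h]
  · simp only [uleg, h, leg, if_false]
    refine (threadDist_pos ha ht (par_mem b) ?_).le
    cases b
    · simpa [par]
    · simpa [par]

theorem uleg_pos {X : Stage} {x : Pt} (hx : X.Valid x) (hn : x ∉ X.carrier) (b : Bool) :
    0 < X.uleg x b := by
  rcases hx with h | ⟨h, p, q, γ, t, rfl, hp, hq, ha, -, ht, h0, h1⟩
  · exact absurd h hn
  · simp only [uleg, h, leg, if_false]
    refine threadDist_pos ha ht (par_mem b) ?_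
    cases b
    · simpa [par]
    · simpa [par]

theorem dist_ufoot {X : Stage} (hX : X.IsMetric) {x : Pt} (hx : X.Valid x) (b b' : Bool)
    (hn : x ∉ X.carrier) : X.dist (X.ufoot x b) (X.ufoot x b') =
      threadDist 1 (X.dist (X.ufoot x false) (X.ufoot x true)) (par b) (par b') := by
  rcases hx with h | ⟨h, p, q, γ, t, rfl, hp, hq, ha, ha1, ht, h0, h1⟩
  · exact absurd h hn
  · simp only [ufoot, h, foot, if_false]
    cases b <;> cases b' <;>
      simp [par, threadDist_self ha.le, threadDist_zero_one ha1, hX.self _ hp,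
        hX.self _ hq, threadDist_comm 1 _ 1 0, hX.comm _ hq _ hp]

theorem uleg_eq {X : Stage} {p q : Pt} {γ : ℕ → ℝ} {t : ℝ} (b : Bool)
    (h : Pt.thread p q γ t ∉ X.carrier) :
    X.uleg (Pt.thread p q γ t) b = threadDist 1 (X.dist p q) t (par b) := by
  simp [uleg, h, leg, par]

theorem ufoot_false {X : Stage} {p q : Pt} {γ : ℕ → ℝ} {t : ℝ}
    (h : Pt.thread p q γ t ∉ X.carrier) : X.ufoot (Pt.thread p q γ t) false = p := by
  simp [ufoot, h, foot]

theorem ufoot_true {X : Stage} {p q : Pt} {γ : ℕ → ℝ} {t : ℝ}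
    (h : Pt.thread p q γ t ∉ X.carrier) : X.ufoot (Pt.thread p q γ t) true = q := by
  simp [ufoot, h, foot]

theorem dist_ufoot_le {X : Stage} (hX : X.IsMetric) {x : Pt} (hx : X.Valid x) (b b' : Bool) :
    X.dist (X.ufoot x b) (X.ufoot x b') ≤ X.uleg x b + X.uleg x b' := by
  by_cases hn : x ∈ X.carrier
  · simp [ufoot, uleg, hn, hX.self x hn]
  · rw [dist_ufoot hX hx b b' hn]
    rcases hx with h | ⟨h, p, q, γ, t, rfl, hp, hq, ha, ha1, ht, h0, h1⟩
    · exact absurd h hn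
    · rw [ufoot_false h, ufoot_true h, uleg_eq b h, uleg_eq b' h, threadDist_comm 1 _ t (par b)]
      exact threadDist_tri ha.le (par_mem b) ht (par_mem b')

theorem uleg_le {X : Stage} (hX : X.IsMetric) {x : Pt} (hx : X.Valid x) (b b' : Bool) :
    X.uleg x b ≤ X.uleg x b' + X.dist (X.ufoot x b') (X.ufoot x b) := by
  by_cases hn : x ∈ X.carrier
  · simp [ufoot, uleg, hn, hX.self x hn]
  · rw [dist_ufoot hX hx b' b hn]
    rcases hx with h | ⟨h, p, q, γ, t, rfl, hp, hq, ha, ha1, ht, h0, h1⟩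
    · exact absurd h hn
    · rw [ufoot_false h, ufoot_true h, uleg_eq b h, uleg_eq b' h]
      exact threadDist_tri ha.le ht (par_mem b') (par_mem b)

theorem through_comm {X : Stage} (hX : X.IsMetric) {x y : Pt} (hx : X.Valid x)
    (hy : X.Valid y) : X.through x y = X.through y x := by
  have key : ∀ {x y : Pt}, X.Valid x → X.Valid y → X.through x y ≤ X.through y x := by
    intro x y hx hy
    obtain ⟨b, b', h⟩ := X.exists_through y x
    rw [h, hX.comm _ (ufoot_mem hy b) _ (ufoot_mem hx b')]
    linarith [X.through_le x y b' b]
  exact le_antisymm (key hx hy) (key hy hx)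

theorem through_tri {X : Stage} (hX : X.IsMetric) {x y z : Pt} (hx : X.Valid x)
    (hy : X.Valid y) (hz : X.Valid z) :
    X.through x z ≤ X.through x y + X.through y z := by
  obtain ⟨b1, b2, h⟩ := X.exists_through x y
  obtain ⟨b3, b4, h'⟩ := X.exists_through y z
  have h1 := X.through_le x z b1 b4
  have h2 := hX.tri _ (ufoot_mem hx b1) _ (ufoot_mem hy b2) _ (ufoot_mem hz b4)
  have h3 := hX.tri _ (ufoot_mem hy b2) _ (ufoot_mem hy b3) _ (ufoot_mem hz b4)
  have h4 := dist_ufoot_le hX hy b2 b3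
  linarith

/-- Two new points on the same thread. -/
def SameThread (X : Stage) (x y : Pt) : Prop :=
  x ∉ X.carrier ∧ y ∉ X.carrier ∧
    ∃ p q γ t t', x = Pt.thread p q γ t ∧ y = Pt.thread p q γ t'

theorem attachDist_same {X : Stage} {p q : Pt} {γ : ℕ → ℝ} {t t' : ℝ}
    (h : Pt.thread p q γ t ∉ X.carrier) (h' : Pt.thread p q γ t' ∉ X.carrier) :
    X.attachDist (Pt.thread p q γ t) (Pt.thread p q γ t') =
      threadDist 1 (X.dist p q) t t' := by
  simp [attachDist, h, h', newDist, threadingDist]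

theorem attachDist_through {X : Stage} (hX : X.IsMetric) {x y : Pt} (hx : X.Valid x)
    (hy : X.Valid y) (hxy : ¬ X.SameThread x y) : X.attachDist x y = X.through x y := by
  by_cases h : x ∈ X.carrier <;> by_cases h' : y ∈ X.carrier
  · simp [attachDist, through, h, h', ufoot, uleg, min2]
  · have hf : ∀ b, X.ufoot y b = foot y b := fun b => by simp [ufoot, h']
    have hc : ∀ b, X.dist (foot y b) x = X.dist x (foot y b) := fun b => by
      rw [← hf]; exact hX.comm _ (ufoot_mem hy b) _ h
    simp [attachDist, through, h, h', ufoot, uleg, min2, hc, add_comm]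
  · simp [attachDist, through, h, h', ufoot, uleg, min2]
  · obtain ⟨-, p, q, γ, t, rfl, hp, hq, ha, ha1, ht, h0, h1⟩ := hx.resolve_left h
    obtain ⟨-, p', q', γ', t', rfl, -, -, ha', ha1', ht', h0', h1'⟩ := hy.resolve_left h'
    by_cases hpq : p = p' ∧ q = q'
    · obtain ⟨rfl, rfl⟩ := hpq
      have hγ : γ ≠ γ' := fun e => hxy ⟨h, h', p, q, γ, t, t', Eq.refl _, by rw [e]⟩
      have e1 : X.attachDist (Pt.thread p q γ t) (Pt.thread p q γ' t') =
          min2 fun b => X.uleg (Pt.thread p q γ t) b + X.uleg (Pt.thread p q γ' t') b := by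
        simp [attachDist, h, h', newDist, threadingDist, hγ, min2, uleg, leg,
          threadDist_comm 1 _ _ t']
      rw [e1]
      have hfe : ∀ b, X.ufoot (Pt.thread p q γ t) b = X.ufoot (Pt.thread p q γ' t') b := by
        intro b
        simp [ufoot, h, h', foot]
      apply le_antisymm
      · obtain ⟨b, b', e⟩ := X.exists_through (Pt.thread p q γ t) (Pt.thread p q γ' t')
        rw [e, hfe]
        refine (min2_le _ b).trans ?_
        have := uleg_le hX hy b b'
        rw [hX.comm _ (ufoot_mem hy _) _ (ufoot_mem hy _)] at this
        linarith
      · obtain ⟨b, e⟩ := exists_min2 fun b =>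
          X.uleg (Pt.thread p q γ t) b + X.uleg (Pt.thread p q γ' t') b
        rw [e]
        refine (X.through_le _ _ b b).trans ?_
        rw [hfe, hX.self _ (ufoot_mem hy b)]
        linarith
    · simp [attachDist, h, h', newDist, hpq, through, uleg, ufoot]

theorem through_same {X : Stage} {x y z : Pt} (hx : X.Valid x)
    (hy : X.Valid y) (hxy : X.SameThread x y) :
    X.through x z ≤ X.attachDist x y + X.through y z := by
  obtain ⟨h, h', p, q, γ, t, t', rfl, rfl⟩ := hxy
  obtain ⟨b, b', e⟩ := X.exists_through (Pt.thread p q γ t') z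
  rw [attachDist_same h h', e]
  refine (X.through_le _ _ b b').trans ?_
  have hfe : X.ufoot (Pt.thread p q γ t) b = X.ufoot (Pt.thread p q γ t') b := by
    simp [ufoot, h, h', foot]
  rw [hfe, uleg_eq b h, uleg_eq b h']
  obtain ⟨-, _, _, _, _, e1, hp, hq, ha, ha1, ht, -⟩ := hx.resolve_left h
  obtain ⟨-, _, _, _, _, e2, -, -, -, -, ht', -⟩ := hy.resolve_left h'
  cases e1
  cases e2
  have := threadDist_tri ha.le ht ht' (par_mem b)
  linarith

theorem same_le_through {X : Stage} (hX : X.IsMetric) {x y : Pt} (hx : X.Valid x)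
    (hy : X.Valid y) (hxy : X.SameThread x y) : X.attachDist x y ≤ X.through x y := by
  obtain ⟨h, h', p, q, γ, t, t', rfl, rfl⟩ := hxy
  obtain ⟨b, b', e⟩ := X.exists_through (Pt.thread p q γ t) (Pt.thread p q γ t')
  have hfe : X.ufoot (Pt.thread p q γ t') b' = X.ufoot (Pt.thread p q γ t) b' := by
    simp [ufoot, h, h', foot]
  rw [attachDist_same h h', e, hfe, dist_ufoot hX hx b b' h, uleg_eq b h, uleg_eq b' h',
    ufoot_false h, ufoot_true h]
  obtain ⟨-, _, _, _, _, e1, hp, hq, ha, ha1, ht, -⟩ := hx.resolve_left h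
  obtain ⟨-, _, _, _, _, e2, -, -, -, -, ht', -⟩ := hy.resolve_left h'
  cases e1
  cases e2
  have h1 := threadDist_tri ha.le ht (par_mem b) ht'
  have h2 := threadDist_tri ha.le (par_mem b) (par_mem b') ht'
  rw [threadDist_comm 1 _ t' (par b')]
  linarith

theorem SameThread.symm {X : Stage} {x y : Pt} (h : X.SameThread x y) : X.SameThread y x := by
  obtain ⟨h, h', p, q, γ, t, t', rfl, rfl⟩ := h
  exact ⟨h', h, p, q, γ, t', t, Eq.refl _, Eq.refl _⟩

theorem SameThread.trans {X : Stage} {x y z : Pt} (h : X.SameThread x y)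
    (h2 : X.SameThread y z) : X.SameThread x z := by
  obtain ⟨h, h', p, q, γ, t, t', rfl, rfl⟩ := h
  obtain ⟨-, h2, _, _, _, _, t2, e, rfl⟩ := h2
  cases e
  exact ⟨h, h2, p, q, γ, t, t2, Eq.refl _, Eq.refl _⟩

theorem attachDist_comm {X : Stage} (hX : X.IsMetric) {x y : Pt} (hx : X.Valid x)
    (hy : X.Valid y) : X.attachDist x y = X.attachDist y x := by
  by_cases hxy : X.SameThread x y
  · obtain ⟨h, h', p, q, γ, t, t', rfl, rfl⟩ := hxy
    rw [attachDist_same h h', attachDist_same h' h, threadDist_comm]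
  · rw [attachDist_through hX hx hy hxy, attachDist_through hX hy hx fun h => hxy h.symm,
      through_comm hX hx hy]

theorem attachDist_tri {X : Stage} (hX : X.IsMetric) {x y z : Pt} (hx : X.Valid x)
    (hy : X.Valid y) (hz : X.Valid z) :
    X.attachDist x z ≤ X.attachDist x y + X.attachDist y z := by
  by_cases hxy : X.SameThread x y <;> by_cases hyz : X.SameThread y z
  · obtain ⟨h, h', p, q, γ, t, t', rfl, rfl⟩ := hxy
    obtain ⟨-, h2, _, _, _, _, t2, e, rfl⟩ := hyz
    cases e
    rw [attachDist_same h h', attachDist_same h h2, attachDist_same h' h2]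
    obtain ⟨-, _, _, _, _, e1, hp, hq, ha, ha1, ht, -⟩ := hx.resolve_left h
    obtain ⟨-, _, _, _, _, e2, -, -, -, -, ht', -⟩ := hy.resolve_left h'
    obtain ⟨-, _, _, _, _, e3, -, -, -, -, ht2, -⟩ := hz.resolve_left h2
    cases e1
    cases e2
    cases e3
    exact threadDist_tri ha.le ht ht' ht2
  · have hxz : ¬ X.SameThread x z := fun h => hyz (hxy.symm.trans h)
    rw [attachDist_through hX hx hz hxz, attachDist_through hX hy hz hyz]
    exact through_same hx hy hxy
  · have hxz : ¬ X.SameThread x z := fun h => hxy (h.trans hyz.symm)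
    rw [attachDist_through hX hx hz hxz, attachDist_through hX hx hy hxy,
      through_comm hX hx hz, through_comm hX hx hy, attachDist_comm hX hy hz]
    linarith [through_same (z := x) hz hy hyz.symm]
  · rw [attachDist_through hX hx hy hxy, attachDist_through hX hy hz hyz]
    refine le_trans ?_ (through_tri hX hx hy hz)
    by_cases hxz : X.SameThread x z
    · exact same_le_through hX hx hz hxz
    · exact (attachDist_through hX hx hz hxz).le

theorem attachDist_self {X : Stage} (hX : X.IsMetric) {x : Pt} (hx : X.Valid x) :
    X.attachDist x x = 0 := by
  rcases hx with h | ⟨h, p, q, γ, t, rfl, hp, hq, ha, ha1, ht, h0, h1⟩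
  · simp [attachDist, h, hX.self x h]
  · rw [attachDist_same h h, threadDist_self ha.le]

theorem attachDist_eq_of {X : Stage} (hX : X.IsMetric) {x y : Pt} (hx : X.Valid x)
    (hy : X.Valid y) (h0 : X.attachDist x y = 0) : x = y := by
  by_cases hxy : X.SameThread x y
  · obtain ⟨h, h', p, q, γ, t, t', rfl, rfl⟩ := hxy
    obtain ⟨-, _, _, _, _, e1, hp, hq, ha, ha1, ht, -⟩ := hx.resolve_left h
    obtain ⟨-, _, _, _, _, e2, -, -, -, -, ht', -⟩ := hy.resolve_left h'
    cases e1
    cases e2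
    rw [attachDist_same h h'] at h0
    by_contra hne
    exact (threadDist_pos ha ht ht' fun e => hne (by rw [e])).ne' h0
  · rw [attachDist_through hX hx hy hxy] at h0
    obtain ⟨b, b', e⟩ := X.exists_through x y
    rw [e] at h0
    have h1 := uleg_nonneg hx b
    have h2 := uleg_nonneg hy b'
    have h3 := hX.nonneg (ufoot_mem hx b) (ufoot_mem hy b')
    have hxc : x ∈ X.carrier := by
      by_contra hn
      linarith [uleg_pos hx hn b]
    have hyc : y ∈ X.carrier := by
      by_contra hn
      linarith [uleg_pos hy hn b']
    have h4 : X.dist (X.ufoot x b) (X.ufoot y b') = 0 := by linarith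
    simp only [ufoot, hxc, hyc, if_true] at h4
    exact hX.eq_of x hxc y hyc h4

theorem succ_isMetric {X : Stage} (hX : X.IsMetric) (e : RatEnum) (o : Orientation) :
    (X.succ e o).IsMetric where
  self _ hx := attachDist_self hX (valid_of_mem hX hx)
  comm _ hx _ hy := attachDist_comm hX (valid_of_mem hX hx) (valid_of_mem hX hy)
  tri _ hx _ hy _ hz :=
    attachDist_tri hX (valid_of_mem hX hx) (valid_of_mem hX hy) (valid_of_mem hX hz)
  eq_of _ hx _ hy h := attachDist_eq_of hX (valid_of_mem hX hx) (valid_of_mem hX hy) h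

theorem succ_extends (X : Stage) (e : RatEnum) (o : Orientation) : Extends X (X.succ e o) :=
  ⟨subset_union_left, fun x hx y hy => by simp [succ, attachDist, hx, hy]⟩

theorem union_extends {ι : Type*} [LinearOrder ι] [WellFoundedLT ι] {F : ι → Stage}
    (hF : ∀ i j, i ≤ j → Extends (F i) (F j)) (i : ι) : Extends (F i) (union F) := by
  refine ⟨fun x hx => mem_iUnion.2 ⟨i, hx⟩, fun x hx y hy => ?_⟩
  have h : {i | x ∈ (F i).carrier ∧ y ∈ (F i).carrier}.Nonempty := ⟨i, hx, hy⟩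
  have e : (union F).dist x y = (F ((wellFounded_lt (α := ι)).min _ h)).dist x y := dif_pos h
  rw [e]
  have hm := (wellFounded_lt (α := ι)).min_mem _ h
  have hle : (wellFounded_lt (α := ι)).min _ h ≤ i :=
    not_lt.1 ((wellFounded_lt (α := ι)).not_lt_min {i | x ∈ (F i).carrier ∧ y ∈ (F i).carrier} ⟨hx, hy⟩)
  exact ((hF _ _ hle).dist_eq x hm.1 y hm.2).symm

theorem union_isMetric {ι : Type*} [LinearOrder ι] [WellFoundedLT ι] {F : ι → Stage}
    (hF : ∀ i j, i ≤ j → Extends (F i) (F j)) (hm : ∀ i, (F i).IsMetric) :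
    (union F).IsMetric := by
  have h2 : ∀ x ∈ (union F).carrier, ∀ y ∈ (union F).carrier,
      ∃ i, x ∈ (F i).carrier ∧ y ∈ (F i).carrier := by
    intro x hx y hy
    obtain ⟨i, hi⟩ := mem_iUnion.1 hx
    obtain ⟨j, hj⟩ := mem_iUnion.1 hy
    exact ⟨max i j, (hF i _ (le_max_left i j)).sub hi, (hF j _ (le_max_right i j)).sub hj⟩
  refine ⟨?_, ?_, ?_, ?_⟩
  · intro x hx
    obtain ⟨i, hi, -⟩ := h2 x hx x hx
    rw [(union_extends hF i).dist_eq x hi x hi, (hm i).self x hi]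
  · intro x hx y hy
    obtain ⟨i, hi, hj⟩ := h2 x hx y hy
    rw [(union_extends hF i).dist_eq x hi y hj, (union_extends hF i).dist_eq y hj x hi,
      (hm i).comm x hi y hj]
  · intro x hx y hy z hz
    obtain ⟨i, hi, hi'⟩ := h2 x hx y hy
    obtain ⟨j, hj⟩ := mem_iUnion.1 hz
    have h1 := (hF i _ (le_max_left i j)).sub hi
    have h2 := (hF i _ (le_max_left i j)).sub hi'
    have h3 := (hF j _ (le_max_right i j)).sub hj
    have e := (union_extends hF (max i j)).dist_eq
    rw [e x h1 z h3, e x h1 y h2, e y h2 z h3]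
    exact (hm _).tri x h1 y h2 z h3
  · intro x hx y hy h
    obtain ⟨i, hi, hj⟩ := h2 x hx y hy
    rw [(union_extends hF i).dist_eq x hi y hj] at h
    exact (hm i).eq_of x hi y hj h

/-- The sequences used to compute distances in the completion. -/
theorem approx_spec {X : Stage} (hX : X.IsMetric) {x : Pt} (hx : x ∈ X.completion.carrier) :
    (∀ n, X.approx x n ∈ X.carrier) ∧
      ∀ ε > 0, ∃ N, ∀ m ≥ N, ∀ n ≥ N, X.dist (X.approx x m) (X.approx x n) < ε := by
  by_cases h : x ∈ X.carrier
  · simp only [approx, h, if_true]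
    exact ⟨fun _ => trivial, fun ε hε => ⟨0, fun _ _ _ _ => by rwa [hX.self x h]⟩⟩
  · obtain ⟨s, ⟨c, rfl⟩, rfl⟩ := hx.resolve_left h
    simp only [approx, h, if_false]
    exact ⟨c.out.2.mem, c.out.2.cauchy⟩

theorem completion_tendsto {X : Stage} (hX : X.IsMetric) {x y : Pt}
    (hx : x ∈ X.completion.carrier) (hy : y ∈ X.completion.carrier) :
    Tendsto (fun n => X.dist (X.approx x n) (X.approx y n)) atTop
      (𝓝 (X.completion.dist x y)) := by
  obtain ⟨mx, cx⟩ := approx_spec hX hx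
  obtain ⟨my, cy⟩ := approx_spec hX hy
  have hc : CauchySeq fun n => X.dist (X.approx x n) (X.approx y n) := by
    rw [Metric.cauchySeq_iff]
    intro ε hε
    obtain ⟨N, hN⟩ := cx (ε / 2) (by linarith)
    obtain ⟨M, hM⟩ := cy (ε / 2) (by linarith)
    refine ⟨max N M, fun m hm n hn => ?_⟩
    have h1 := hN m (le_trans (le_max_left _ _) hm) n (le_trans (le_max_left _ _) hn)
    have h2 := hM m (le_trans (le_max_right _ _) hm) n (le_trans (le_max_right _ _) hn)
    have t1 := hX.tri _ (mx m) _ (mx n) _ (my m)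
    have t2 := hX.tri _ (mx n) _ (my n) _ (my m)
    have t3 := hX.tri _ (mx n) _ (mx m) _ (my n)
    have t4 := hX.tri _ (mx m) _ (my m) _ (my n)
    rw [hX.comm _ (my n) _ (my m)] at t2
    rw [hX.comm _ (mx n) _ (mx m)] at t3
    rw [Real.dist_eq, abs_lt]
    constructor <;> linarith
  exact tendsto_nhds_limUnder (cauchySeq_tendsto_of_complete hc)

theorem approx_old {X : Stage} {x : Pt} (hx : x ∈ X.carrier) (n : ℕ) : X.approx x n = x := by
  simp [approx, hx]

theorem completion_extends {X : Stage} (hX : X.IsMetric) : Extends X X.completion := by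
  refine ⟨subset_union_left, fun x hx y hy => ?_⟩
  have h := completion_tendsto hX (Or.inl hx) (Or.inl hy)
  simp only [approx_old hx, approx_old hy] at h
  exact tendsto_nhds_unique h tendsto_const_nhds

theorem completion_comm {X : Stage} (hX : X.IsMetric) {x y : Pt}
    (hx : x ∈ X.completion.carrier) (hy : y ∈ X.completion.carrier) :
    X.completion.dist x y = X.completion.dist y x := by
  refine tendsto_nhds_unique (completion_tendsto hX hx hy) ?_
  refine (completion_tendsto hX hy hx).congr fun n => ?_
  exact hX.comm _ ((approx_spec hX hy).1 n) _ ((approx_spec hX hx).1 n)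

theorem completion_new_old {X : Stage} (hX : X.IsMetric) {x y : Pt}
    (hx : x ∈ X.completion.carrier) (hn : x ∉ X.carrier) (hy : y ∈ X.carrier) :
    X.completion.dist x y ≠ 0 := by
  intro h
  have ht := completion_tendsto hX hx (Or.inl hy)
  rw [h] at ht
  simp only [approx_old hy] at ht
  obtain ⟨s, ⟨c, rfl⟩, rfl⟩ := hx.resolve_left hn
  simp only [approx, hn, if_false] at ht
  exact c.out.2.free ⟨y, hy, ht⟩

theorem completion_isMetric {X : Stage} (hX : X.IsMetric) : X.completion.IsMetric := by
  refine ⟨?_, fun x hx y hy => completion_comm hX hx hy, ?_, ?_⟩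
  · intro x hx
    refine tendsto_nhds_unique (completion_tendsto hX hx hx) ?_
    simp only [hX.self _ ((approx_spec hX hx).1 _)]
    exact tendsto_const_nhds
  · intro x hx y hy z hz
    refine le_of_tendsto_of_tendsto' (completion_tendsto hX hx hz)
      ((completion_tendsto hX hx hy).add (completion_tendsto hX hy hz)) fun n => ?_
    exact hX.tri _ ((approx_spec hX hx).1 n) _ ((approx_spec hX hy).1 n) _
      ((approx_spec hX hz).1 n)
  · intro x hx y hy h
    by_cases h1 : x ∈ X.carrier
    · by_cases h2 : y ∈ X.carrier
      · rw [(completion_extends hX).dist_eq x h1 y h2] at h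
        exact hX.eq_of x h1 y h2 h
      · rw [completion_comm hX hx hy] at h
        exact absurd h (completion_new_old hX hy h2 h1)
    · by_cases h2 : y ∈ X.carrier
      · exact absurd h (completion_new_old hX hx h1 h2)
      · have ht := completion_tendsto hX hx hy
        rw [h] at ht
        obtain ⟨s, ⟨c, rfl⟩, rfl⟩ := hx.resolve_left h1
        obtain ⟨s', ⟨c', rfl⟩, rfl⟩ := hy.resolve_left h2
        simp only [approx, h1, h2, if_false] at ht
        have hcc : c = c' := by
          rw [← c.out_eq, ← c'.out_eq]
          exact Quot.sound ht
        rw [hcc]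

end Stage

theorem stage_invariant (e : RatEnum) (o : Orientation) (β : Ordinal.{0}) :
    (stage e o β).IsMetric ∧ ∀ α ≤ β, Stage.Extends (stage e o α) (stage e o β) := by
  induction β using Ordinal.limitRecOn with
  | zero =>
    rw [stage_zero]
    refine ⟨Stage.zero_isMetric, fun α hα => ?_⟩
    rw [nonpos_iff_eq_zero.1 hα, stage_zero]
    exact Stage.Extends.rfl
  | add_one β ih =>
    refine ⟨?_, fun α hα => ?_⟩
    · rw [stage_add_one]
      exact Stage.succ_isMetric ih.1 e o
    · rcases hα.lt_or_eq with h | rfl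
      · rw [stage_add_one]
        exact (ih.2 α (Order.lt_add_one_iff.1 h)).trans (Stage.succ_extends _ e o)
      · exact Stage.Extends.rfl
  | limit κ hκ ih =>
    have hF : ∀ i j : Iio κ, i ≤ j → Stage.Extends (stage e o i.1) (stage e o j.1) :=
      fun i j hij => (ih j.1 j.2).2 i.1 hij
    have hU := Stage.union_isMetric hF fun i => (ih i.1 i.2).1
    refine ⟨?_, fun α hα => ?_⟩
    · rw [stage_limit e o hκ]
      exact Stage.completion_isMetric hU
    · rcases hα.lt_or_eq with h | rfl
      · rw [stage_limit e o hκ]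
        exact (Stage.union_extends hF ⟨α, h⟩).trans (Stage.completion_extends hU)
      · exact Stage.Extends.rfl

/-- The field `old` is the union of the previous skeins. -/
theorem stage_old (e : RatEnum) (o : Orientation) (β : Ordinal.{0}) :
    (stage e o β).old = ⋃ α : Iio β, (stage e o α.1).carrier := by
  induction β using Ordinal.limitRecOn with
  | zero => simp [stage_zero, Stage.zero]
  | add_one β ih =>
    rw [stage_add_one]
    refine Subset.antisymm (fun x hx => mem_iUnion.2 ⟨⟨β, lt_add_one β⟩, hx⟩) ?_
    exact iUnion_subset fun α =>
      ((stage_invariant e o β).2 α.1 (Order.lt_add_one_iff.1 α.2)).sub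
  | limit κ hκ ih => rw [stage_limit e o hκ]; rfl

theorem thread_mem (e : RatEnum) (o : Orientation) (β : Ordinal.{0}) {p q : Pt} {γ : ℕ → ℝ}
    {t : ℝ} (h : Pt.thread p q γ t ∈ (stage e o β).carrier) :
    p ∈ (stage e o β).old ∧ q ∈ (stage e o β).old := by
  induction β using Ordinal.limitRecOn with
  | zero => simp [stage_zero, Stage.zero] at h
  | add_one β ih =>
    rw [stage_add_one] at h ⊢
    rcases h with h | h
    · rw [stage_old] at ih
      have hsub : ∀ x ∈ ⋃ α : Iio β, (stage e o α.1).carrier, x ∈ (stage e o β).carrier := by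
        intro x hx
        obtain ⟨α, hα⟩ := mem_iUnion.1 hx
        exact ((stage_invariant e o β).2 α.1 (le_of_lt α.2)).sub hα
      exact ⟨hsub _ (ih h).1, hsub _ (ih h).2⟩
    · obtain ⟨_, _, _, _, e1, hp, hq, -⟩ := Stage.isNew_of_mem (stage_invariant e o β).1 h
      cases e1
      exact ⟨hp, hq⟩
  | limit κ hκ ih =>
    have h' := h
    rw [stage_limit e o hκ] at h'
    rcases h' with h' | ⟨s, -, h'⟩
    · obtain ⟨α, hα⟩ := mem_iUnion.1 h'
      have hsub : ∀ x ∈ (stage e o α.1).old, x ∈ (stage e o κ).old := by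
        intro x hx
        rw [stage_old] at hx ⊢
        obtain ⟨α', hx⟩ := mem_iUnion.1 hx
        exact mem_iUnion.2 ⟨⟨α'.1, mem_Iio.2 (lt_trans (mem_Iio.1 α'.2) (mem_Iio.1 α.2))⟩, hx⟩
      exact ⟨hsub _ (ih α.1 α.2 hα).1, hsub _ (ih α.1 α.2 hα).2⟩
    · cases h'

/-- The labels added at a successor step are really new. -/
theorem newPts_disjoint (e : RatEnum) (o : Orientation) (β : Ordinal.{0}) :
    Disjoint ((stage e o β).newPts e o) (stage e o β).carrier := by
  rw [Set.disjoint_left]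
  rintro x ⟨z, ⟨p, hp, q, hq, hz, -⟩, γ, -, t, -, -, -, rfl⟩ hx
  have h := thread_mem e o β hx
  have hs := o.spec z
  rw [hz, Sym2.eq_iff] at hs
  rw [hz] at h
  rcases hs with ⟨-, hb⟩ | ⟨ha, -⟩
  · rw [hb] at h
    exact hq.2 h.2
  · rw [ha] at h
    exact hq.2 h.1

/-- A label `lim s` belonging to a skein is the limit of the sequence `s`. -/
theorem lim_mem (e : RatEnum) (o : Orientation) (β : Ordinal.{0}) {s : ℕ → Pt}
    (h : Pt.lim s ∈ (stage e o β).carrier) : (∀ n, s n ∈ (stage e o β).carrier) ∧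
      Tendsto (fun n => (stage e o β).dist (s n) (Pt.lim s)) atTop (𝓝 0) := by
  have up : ∀ {X Y : Stage}, Stage.Extends X Y → Pt.lim s ∈ X.carrier →
      ((∀ n, s n ∈ X.carrier) ∧ Tendsto (fun n => X.dist (s n) (Pt.lim s)) atTop (𝓝 0)) →
      ((∀ n, s n ∈ Y.carrier) ∧ Tendsto (fun n => Y.dist (s n) (Pt.lim s)) atTop (𝓝 0)) := by
    intro X Y hXY hl ⟨h1, h2⟩
    refine ⟨fun n => hXY.sub (h1 n), h2.congr fun n => ?_⟩
    rw [hXY.dist_eq _ (h1 n) _ hl]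
  induction β using Ordinal.limitRecOn with
  | zero => simp [stage_zero, Stage.zero] at h
  | add_one β ih =>
    rw [stage_add_one] at h
    rcases h with h | ⟨_, _, _, _, _, _, _, _, h⟩
    · exact up ((stage_invariant e o (β + 1)).2 β (le_of_lt (lt_add_one β))) h (ih h)
    · cases h
  | limit κ hκ ih =>
    by_cases hU : ∃ α : Iio κ, Pt.lim s ∈ (stage e o α.1).carrier
    · obtain ⟨α, hα⟩ := hU
      exact up ((stage_invariant e o κ).2 α.1 (le_of_lt α.2)) hα (ih α.1 α.2 hα)
    · have hF : ∀ i j : Iio κ, i ≤ j → Stage.Extends (stage e o i.1) (stage e o j.1) :=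
        fun i j hij => (stage_invariant e o j.1).2 i.1 hij
      have hm := Stage.union_isMetric hF fun i => (stage_invariant e o i.1).1
      rw [stage_limit e o hκ] at h ⊢
      generalize hX : (Stage.union fun α : Iio κ => stage e o α.1) = X at *
      have hn : Pt.lim s ∉ X.carrier := by
        rw [← hX]
        exact fun h => hU (mem_iUnion.1 h)
      obtain ⟨_, ⟨c, rfl⟩, hc⟩ := h.resolve_left hn
      cases hc
      have hs := c.out.2
      refine ⟨fun n => Or.inl (hs.mem n), ?_⟩
      rw [Metric.tendsto_atTop]
      intro ε hε
      obtain ⟨N, hN⟩ := hs.cauchy (ε / 2) (by linarith)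
      refine ⟨N, fun n hn' => ?_⟩
      have ht := Stage.completion_tendsto hm (Or.inl (hs.mem n)) h
      have hle : X.completion.dist (c.out.1 n) (Pt.lim c.out.1) ≤ ε / 2 := by
        refine le_of_tendsto ht (eventually_atTop.2 ⟨N, fun m hm' => ?_⟩)
        rw [Stage.approx_old (hs.mem n)]
        simp only [Stage.approx, hn, if_false]
        exact (hN n hn' m hm').le
      have h0 := (Stage.completion_isMetric hm).nonneg (Or.inl (hs.mem n)) h
      rw [Real.dist_eq, sub_zero, abs_of_nonneg h0]
      linarith

/-- The labels added at a limit step are really new. -/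
theorem limitReps_disjoint (e : RatEnum) (o : Orientation) (κ : Ordinal.{0}) :
    Disjoint (Pt.lim '' (Stage.union fun α : Iio κ => stage e o α.1).limitReps)
      (Stage.union fun α : Iio κ => stage e o α.1).carrier := by
  rw [Set.disjoint_left]
  rintro _ ⟨_, ⟨c, rfl⟩, rfl⟩ hx
  obtain ⟨α, hα⟩ := mem_iUnion.1 hx
  have h := lim_mem e o α.1 hα
  have hE := Stage.union_extends (F := fun α : Iio κ => stage e o α.1)
    (fun i j hij => (stage_invariant e o j.1).2 i.1 hij) α
  refine c.out.2.free ⟨_, hx, h.2.congr fun n => ?_⟩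
  rw [hE.dist_eq _ (h.1 n) _ hα]

/-! ### The skein spaces as metric spaces -/

/-- The `β`-skein space `Sk(β)`. -/
def Sk (e : RatEnum) (o : Orientation) (β : Ordinal.{0}) : Type :=
  ↥(stage e o β).carrier

instance (e : RatEnum) (o : Orientation) (β : Ordinal.{0}) : MetricSpace (Sk e o β) where
  dist x y := (stage e o β).dist x.1 y.1
  dist_self x := (stage_invariant e o β).1.self _ x.2
  dist_comm x y := (stage_invariant e o β).1.comm _ x.2 _ y.2
  dist_triangle x y z := (stage_invariant e o β).1.tri _ x.2 _ y.2 _ z.2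
  eq_of_dist_eq_zero {x y} h := Subtype.ext ((stage_invariant e o β).1.eq_of _ x.2 _ y.2 h)

/-- `Sk(β)` as a subset of `Sk(ω₁)`. -/
def SkIn (e : RatEnum) (o : Orientation) (β : Ordinal.{0}) : Set (Sk e o ω₁) :=
  {x | x.1 ∈ (stage e o β).carrier}

/-- The set `P_β(p)` of nearest points of `p` in `Sk(β)`. -/
def ancestors (e : RatEnum) (o : Orientation) (β : Ordinal.{0}) (p : Sk e o ω₁) :
    Set (Sk e o ω₁) :=
  {x | x ∈ SkIn e o β ∧ dist p x = Metric.infDist p (SkIn e o β)}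

/-- The open ball of radius `1 / 8` around `Sk(β)` in `Sk(ω₁)`. -/
def ball (e : RatEnum) (o : Orientation) (β : Ordinal.{0}) : Set (Sk e o ω₁) :=
  Metric.thickening (1 / 8) (SkIn e o β)

/-- `R` is a `K`-Lipschitz retraction from `M` onto `S`. -/
structure IsLipschitzRetraction {X : Type*} [MetricSpace X] (K : NNReal) (M S : Set X)
    (R : M → X) : Prop where
  subset : S ⊆ M
  maps : ∀ x, R x ∈ S
  fix : ∀ x : M, x.1 ∈ S → R x = x
  lipschitz : LipschitzWith K R

/-- `S` is `β`-stable: every point of `S` has a unique nearest point in `Sk(β)`, and the resulting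
map is a `1`-Lipschitz retraction from `S` onto `Sk(β)`. -/
def IsStable (e : RatEnum) (o : Orientation) (β : Ordinal.{0}) (S : Set (Sk e o ω₁)) : Prop :=
  SkIn e o β ⊆ S ∧ ∃ P : S → Sk e o ω₁,
    (∀ p : S, ancestors e o β p.1 = {P p}) ∧ IsLipschitzRetraction 1 S (SkIn e o β) P

end Skein

end

noncomputable section

namespace Skein

/-! ### Gates in metric spaces -/

section Gates

variable {M : Type*} [MetricSpace M]

/-! The proof replaces nearest points by gates. If `p` has a gate `x` in `S`, then `d(p,·) = d(p,x)
+ d(x,·)` on `S`. So `x` is the only nearest point, and adding two gate identities shows that gates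
of different points are no farther apart than the points themselves (`IsGate.dist_gate_le`).
Uniqueness and the Lipschitz bound are therefore formal. What remains is that points closer than
`1/8` to `Sk(β)` have gates there, and that two of them with different gates are joined through
their gates. This is `IsGated (1/8)`, proved for `Sk(β)` inside `Sk(α)` by induction on `α` from `β`
up to `ω₁` (`isGated_SkIn`).

Successor step (`isGated_add_one`): a path from a new point to an older one leaves its thread
through an anchor, so a new point closer than `1/8` to `Sk(β)` is closer than `1/8` to an anchor. As
the anchors are at distance `a ≤ 1/2`, even the path to the other anchor then runs through the close
anchor `u`. Hence `d(p,·)` and `d(u,·)` differ by a constant on `Sk(α)`, and `p` inherits the gates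
of `u` (`isGate_anchor`). Two such points with different close anchors are joined through them; on a
common thread this holds because from `t < 1/8` to `1 - t' < 1/8` the route through both ends costs
at most `1/4 + a ≤ 3/4 ≤ |t - t'|`.

Limit step (`IsGated.closure`): the union of the earlier skeins is dense, and gates of a convergent
sequence form a Cauchy sequence in `Sk(β)`. This needs `Sk(β)` to be complete, which is a separate
induction (`isComplete_SkIn`). -/

/-- `x` is a gate of `p` in `S`: every point of `S` is reached from `p` through `x`. -/
def IsGate (S : Set M) (p x : M) : Prop :=
  x ∈ S ∧ ∀ y ∈ S, dist p y = dist p x + dist x y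

/-- Points of `D` closer than `r` to `S` have gates in `S`, and two such points with different
gates are joined through their gates. -/
structure IsGated (r : ℝ) (S D : Set M) : Prop where
  exists_gate : ∀ p ∈ D, ∀ y ∈ S, dist p y < r → ∃ x, IsGate S p x
  dist_eq : ∀ p ∈ D, ∀ q ∈ D, ∀ x y, IsGate S p x → IsGate S q y → dist p x < r →
    dist q y < r → x ≠ y → dist p q = dist p x + dist x y + dist y q

theorem IsGate.dist_le {S : Set M} {p x y : M} (h : IsGate S p x) (hy : y ∈ S) :
    dist p x ≤ dist p y := by
  rw [h.2 y hy]
  linarith [dist_nonneg (x := x) (y := y)]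

theorem isGate_self {S : Set M} {p : M} (hp : p ∈ S) : IsGate S p p :=
  ⟨hp, fun y _ => by simp⟩

theorem IsGate.eq_of_mem {S : Set M} {p x : M} (h : IsGate S p x) (hp : p ∈ S) : x = p := by
  have h1 := h.2 p hp
  rw [dist_self, dist_comm x p] at h1
  exact (dist_le_zero.1 (by linarith [dist_nonneg (x := p) (y := x)])).symm

theorem IsGate.infDist_eq {S : Set M} {p x : M} (h : IsGate S p x) :
    Metric.infDist p S = dist p x :=
  le_antisymm (Metric.infDist_le_dist_of_mem h.1)
    ((Metric.le_infDist ⟨x, h.1⟩).2 fun _ hy => h.dist_le hy)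

theorem IsGate.eq_of_dist_eq_infDist {S : Set M} {p x y : M} (h : IsGate S p x) (hy : y ∈ S)
    (hd : dist p y = Metric.infDist p S) : y = x := by
  rw [h.infDist_eq, h.2 y hy] at hd
  exact (dist_eq_zero.1 (by linarith)).symm

/-- Gates of different points differ at most by the distance of the points. -/
theorem IsGate.dist_gate_le {S : Set M} {p q x y : M} (hp : IsGate S p x) (hq : IsGate S q y) :
    dist x y ≤ dist p q := by
  have h1 := hp.2 y hq.1
  have h2 := hq.2 x hp.1
  -- Adding the two triangle inequalities to the two gate identities cancels `d(p,x)` and `d(q,y)`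
  -- and leaves `2 d(x,y) ≤ 2 d(p,q)`.
  have h3 := dist_triangle p q y
  have h4 := dist_triangle q p x
  rw [dist_comm q p] at h4
  rw [dist_comm y x] at h2
  linarith

theorem isGated_self (r : ℝ) (S : Set M) : IsGated r S S where
  exists_gate p hp _ _ _ := ⟨p, isGate_self hp⟩
  dist_eq p hp q hq x y hx hy _ _ _ := by
    rw [hx.eq_of_mem hp, hy.eq_of_mem hq]
    simp

theorem IsGated.mono {r : ℝ} {S D E : Set M} (h : IsGated r S D) (hE : E ⊆ D) : IsGated r S E where
  exists_gate p hp := h.exists_gate p (hE hp)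
  dist_eq p hp q hq := h.dist_eq p (hE hp) q (hE hq)

theorem IsGated.iUnion {ι : Type*} [LinearOrder ι] {r : ℝ} {S : Set M} {D : ι → Set M}
    (hD : Monotone D) (h : ∀ i, IsGated r S (D i)) : IsGated r S (⋃ i, D i) where
  exists_gate p hp := by
    obtain ⟨i, hi⟩ := mem_iUnion.1 hp
    exact (h i).exists_gate p hi
  dist_eq p hp q hq := by
    obtain ⟨i, hi⟩ := mem_iUnion.1 hp
    obtain ⟨j, hj⟩ := mem_iUnion.1 hq
    exact (h (max i j)).dist_eq p (hD (le_max_left i j) hi) q (hD (le_max_right i j) hj)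

theorem isComplete_of_cauchySeq {S : Set M}
    (h : ∀ u : ℕ → M, (∀ n, u n ∈ S) → CauchySeq u → ∃ x ∈ S, Tendsto u atTop (𝓝 x)) :
    IsComplete S := by
  rw [← completeSpace_coe_iff_isComplete]
  refine Metric.complete_of_cauchySeq_tendsto fun u hu => ?_
  obtain ⟨x, hx, hlim⟩ := h (fun n => u n) (fun n => (u n).2)
    (hu.map uniformContinuous_subtype_val)
  exact ⟨⟨x, hx⟩, tendsto_subtype_rng.2 hlim⟩

/-- A Cauchy sequence that comes arbitrarily close to `D` again and again converges in `S` if all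
Cauchy sequences of `D` do. -/
theorem exists_tendsto_of_frequently_near {D S : Set M}
    (hD : ∀ v : ℕ → M, (∀ n, v n ∈ D) → CauchySeq v → ∃ x ∈ S, Tendsto v atTop (𝓝 x))
    {u : ℕ → M} (hu : CauchySeq u) (h : ∀ ε > 0, ∀ N, ∃ n ≥ N, ∃ y ∈ D, dist (u n) y < ε) :
    ∃ x ∈ S, Tendsto u atTop (𝓝 x) := by
  -- The `k`-th choice has index at least `k` and error below `1/(k+1)`, so `φ` tends to infinity
  -- and `v` shadows `u ∘ φ`. The limit of `v` is then a limit of `u`, because `u` is Cauchy.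
  choose φ hφ v hv hd using fun k : ℕ => h (1 / ((k : ℝ) + 1)) (by positivity) k
  have hφt : Tendsto φ atTop atTop := tendsto_atTop_mono hφ tendsto_id
  have hd0 : Tendsto (fun k => dist (u (φ k)) (v k)) atTop (𝓝 0) :=
    squeeze_zero (fun _ => dist_nonneg) (fun k => (hd k).le) tendsto_one_div_add_atTop_nhds_zero_nat
  have hc : CauchySeq v := by
    rw [Metric.cauchySeq_iff]
    intro ε hε
    obtain ⟨N, hN⟩ := Metric.cauchySeq_iff.1 (hu.comp_tendsto hφt) (ε / 3) (by linarith)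
    obtain ⟨K, hK⟩ := eventually_atTop.1 (hd0.eventually_lt_const (by linarith : 0 < ε / 3))
    refine ⟨max N K, fun m hm n hn => ?_⟩
    have h1 := hN m (le_of_max_le_left hm) n (le_of_max_le_left hn)
    have h2 := hK m (le_of_max_le_right hm)
    have h3 := hK n (le_of_max_le_right hn)
    have h4 := dist_triangle4 (v m) (u (φ m)) (u (φ n)) (v n)
    rw [dist_comm (v m) (u (φ m))] at h4
    simp only [Function.comp_apply] at h1
    linarith
  obtain ⟨x, hx, hlim⟩ := hD v hv hc
  have hd0' : Tendsto (fun k => dist (v k) ((u ∘ φ) k)) atTop (𝓝 0) :=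
    hd0.congr fun k => dist_comm _ _
  exact ⟨x, hx, tendsto_nhds_of_cauchySeq_of_subseq hu hφt (hlim.congr_dist hd0')⟩

/-- Being closer than `r` to the fixed point `y` is an open condition, so it passes to a tail of the
sequence. -/
theorem IsGated.eventually_exists_gate {r : ℝ} {S D : Set M} (h : IsGated r S D) {p y : M}
    (hy : y ∈ S) (hp : dist p y < r) {u : ℕ → M} (hu : ∀ n, u n ∈ D)
    (hlim : Tendsto u atTop (𝓝 p)) : ∃ N, ∀ n ≥ N, ∃ x, IsGate S (u n) x ∧ dist (u n) x < r := by
  have h1 : ∀ᶠ n in atTop, dist (u n) y < r :=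
    (hlim.dist tendsto_const_nhds).eventually_lt_const hp
  obtain ⟨N, hN⟩ := eventually_atTop.1 h1
  refine ⟨N, fun n hn => ?_⟩
  obtain ⟨x, hx⟩ := h.exists_gate (u n) (hu n) y hy (hN n hn)
  exact ⟨x, hx, (hx.dist_le hy).trans_lt (hN n hn)⟩

/-- A sequence in `D` converging to a point close to `S`, together with its gates. -/
theorem IsGated.exists_seq {r : ℝ} {S D : Set M} (h : IsGated r S D) {p y : M}
    (hp : p ∈ closure D) (hy : y ∈ S) (hd : dist p y < r) : ∃ u x : ℕ → M,
      (∀ n, u n ∈ D) ∧ Tendsto u atTop (𝓝 p) ∧ ∀ n, IsGate S (u n) (x n) ∧ dist (u n) (x n) < r := by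
  obtain ⟨u, hu, hlim⟩ := mem_closure_iff_seq_limit.1 hp
  obtain ⟨N, hN⟩ := h.eventually_exists_gate hy hd hu hlim
  choose x hx using fun n => hN (n + N) (Nat.le_add_left N n)
  exact ⟨fun n => u (n + N), x, fun n => hu _, hlim.comp (tendsto_add_atTop_nat N), hx⟩

/-- Since gates move no more than their points, gates along a convergent sequence are Cauchy.
Completeness of `S` gives a limit, and both identities survive by continuity of the distance. -/
theorem IsGated.closure {r : ℝ} {S D : Set M} (hS : IsComplete S) (h : IsGated r S D) :
    IsGated r S (closure D) where
  exists_gate p hp y hy hd := by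
    obtain ⟨u, x, hu, hlim, hx⟩ := h.exists_seq hp hy hd
    have hc : CauchySeq x := by
      rw [Metric.cauchySeq_iff]
      intro ε hε
      obtain ⟨N, hN⟩ := Metric.cauchySeq_iff.1 hlim.cauchySeq ε hε
      exact ⟨N, fun m hm n hn =>
        ((hx m).1.dist_gate_le (hx n).1).trans_lt (hN m hm n hn)⟩
    obtain ⟨z, hz, hxz⟩ := cauchySeq_tendsto_of_isComplete hS (fun n => (hx n).1.1) hc
    refine ⟨z, hz, fun w hw => ?_⟩
    refine tendsto_nhds_unique (hlim.dist tendsto_const_nhds) ?_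
    refine ((hlim.dist hxz).add (hxz.dist tendsto_const_nhds)).congr fun n => ?_
    exact ((hx n).1.2 w hw).symm
  dist_eq p hp q hq x y hx hy hpx hqy hxy := by
    obtain ⟨u, x', hu, hlim, hx'⟩ := h.exists_seq hp hx.1 hpx
    obtain ⟨v, y', hv, hlim', hy'⟩ := h.exists_seq hq hy.1 hqy
    have key : ∀ {p x : M} {u x' : ℕ → M}, IsGate S p x → Tendsto u atTop (𝓝 p) →
        (∀ n, IsGate S (u n) (x' n) ∧ dist (u n) (x' n) < r) → Tendsto x' atTop (𝓝 x) := by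
      intro p x u x' hx hlim hx'
      exact tendsto_iff_dist_tendsto_zero.2 (squeeze_zero (fun _ => dist_nonneg)
        (fun n => (hx' n).1.dist_gate_le hx) (tendsto_iff_dist_tendsto_zero.1 hlim))
    have hxx := key hx hlim hx'
    have hyy := key hy hlim' hy'
    refine tendsto_nhds_unique (hlim.dist hlim') ?_
    refine (((hlim.dist hxx).add (hxx.dist hyy)).add (hyy.dist hlim')).congr' ?_
    -- The limits of the gates differ, so the approximating gates eventually differ, as the distance
    -- formula requires.
    filter_upwards [(hxx.dist hyy).eventually_const_lt (dist_pos.2 hxy)] with n hn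
    exact (h.dist_eq _ (hu n) _ (hv n) _ _ (hx' n).1 (hy' n).1 (hx' n).2 (hy' n).2
      (dist_pos.1 hn)).symm

end Gates

/-! ### New points close to an anchor -/

theorem threadDist_par_false {a t : ℝ} (ha : 0 < a) (ht : t ∈ Icc (0 : ℝ) 1) :
    threadDist 1 a t (Stage.par false) = min t (1 - t + a) := by
  obtain ⟨h0, h1⟩ := ht
  simp only [threadDist, Stage.par, Bool.false_eq_true, if_false, sub_zero, abs_of_nonneg h0]
  grind

theorem threadDist_par_true {a t : ℝ} (ht : t ∈ Icc (0 : ℝ) 1) :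
    threadDist 1 a t (Stage.par true) = min (1 - t) (t + a) := by
  obtain ⟨h0, h1⟩ := ht
  simp only [threadDist, Stage.par, if_true, abs_sub_comm t 1, abs_of_nonneg (sub_nonneg.2 h1)]
  grind

/-- The parameter `t` is closer than `1 / 8` to the anchor `b`, which is the closest one. -/
def NearAnchor (a t : ℝ) (b : Bool) : Prop :=
  threadDist 1 a t (Stage.par b) < 1 / 8 ∧
    ∀ b', threadDist 1 a t (Stage.par b) ≤ threadDist 1 a t (Stage.par b')

/-- Minimality rules out reaching `0` by way of `1`: that route costs `1 - t + a`, more than the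
distance `1 - t` to the anchor `1`. -/
theorem NearAnchor.false_iff {a t : ℝ} (ha : 0 < a) (ha' : a ≤ 1 / 2) (ht : t ∈ Icc (0 : ℝ) 1) :
    NearAnchor a t false ↔ t < 1 / 8 := by
  simp only [NearAnchor, Bool.forall_bool, threadDist_par_false ha ht, threadDist_par_true ht]
  obtain ⟨h0, h1⟩ := ht
  grind

theorem NearAnchor.true_iff {a t : ℝ} (ha : 0 < a) (ha' : a ≤ 1 / 2) (ht : t ∈ Icc (0 : ℝ) 1) :
    NearAnchor a t true ↔ 1 - t < 1 / 8 := by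
  simp only [NearAnchor, Bool.forall_bool, threadDist_par_false ha ht, threadDist_par_true ht]
  obtain ⟨h0, h1⟩ := ht
  grind

/-- For `t < 1/8` and `a ≤ 1/2` one has `t + a < 5/8 < 7/8 < 1 - t`: going back to the close end and
jumping beats walking along the thread. The other end is symmetric. -/
theorem NearAnchor.threadDist_par {a t : ℝ} {b : Bool} (h : NearAnchor a t b) (ha : 0 < a)
    (ha' : a ≤ 1 / 2) (ht : t ∈ Icc (0 : ℝ) 1) (b' : Bool) :
    threadDist 1 a t (Stage.par b') =
      threadDist 1 a t (Stage.par b) + threadDist 1 a (Stage.par b) (Stage.par b') := by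
  have e := threadDist_par_false ha ht
  have e' := threadDist_par_true (a := a) ht
  have e01 := Stage.threadDist_zero_one (a := a) (by linarith)
  have e10 := Stage.threadDist_comm 1 a 1 0
  have h' := ht
  obtain ⟨h0, h1⟩ := h'
  cases b
  · rw [NearAnchor.false_iff ha ha' ht] at h
    cases b'
    · rw [Stage.threadDist_self ha.le, add_zero]
    · rw [e, e']
      simp only [Stage.par, if_true, Bool.false_eq_true, if_false, e01]
      rw [min_eq_right (by linarith : t + a ≤ 1 - t), min_eq_left (by linarith : t ≤ 1 - t + a)]
  · rw [NearAnchor.true_iff ha ha' ht] at h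
    cases b'
    · rw [e, e']
      simp only [Stage.par, if_true, Bool.false_eq_true, if_false, e10, e01]
      rw [min_eq_right (by linarith : 1 - t + a ≤ t), min_eq_left (by linarith : 1 - t ≤ t + a)]
    · rw [Stage.threadDist_self ha.le, add_zero]

/-- The radius `1/8` comes from here. Walking costs `|t - t'| ≥ 3/4`, while the route through both
ends costs at most `1/8 + 1/8 + a ≤ 3/4`; with `a = 1/2` there is no slack left. -/
theorem NearAnchor.threadDist_eq {a t t' : ℝ} {b b' : Bool} (h : NearAnchor a t b)
    (h' : NearAnchor a t' b') (hb : b ≠ b') (ha : 0 < a) (ha' : a ≤ 1 / 2)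
    (ht : t ∈ Icc (0 : ℝ) 1) (ht' : t' ∈ Icc (0 : ℝ) 1) :
    threadDist 1 a t t' = threadDist 1 a t (Stage.par b) +
      threadDist 1 a (Stage.par b) (Stage.par b') + threadDist 1 a t' (Stage.par b') := by
  have key : ∀ {t t' : ℝ}, t ∈ Icc (0 : ℝ) 1 → t' ∈ Icc (0 : ℝ) 1 → t < 1 / 8 → 1 - t' < 1 / 8 →
      threadDist 1 a t t' = threadDist 1 a t (Stage.par false) +
      threadDist 1 a (Stage.par false) (Stage.par true) + threadDist 1 a t' (Stage.par true) := by
    intro t t' ht ht' h h'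
    rw [threadDist_par_false ha ht, threadDist_par_true ht']
    simp only [Stage.par, if_true, Bool.false_eq_true, if_false]
    rw [Stage.threadDist_zero_one (by linarith)]
    obtain ⟨h0, h1⟩ := ht
    obtain ⟨h0', h1'⟩ := ht'
    rw [threadDist, min_eq_left (by linarith : t ≤ 1 - t + a),
      min_eq_left (by linarith : 1 - t' ≤ t' + a), abs_of_nonpos (by linarith),
      min_eq_left (by linarith : t + (1 - t') + a ≤ t' + (1 - t) + a), min_eq_right (by linarith)]
    ring
  cases b <;> cases b'
  · exact absurd rfl hb
  · exact key ht ht' ((false_iff ha ha' ht).1 h) ((true_iff ha ha' ht').1 h')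
  · rw [Stage.threadDist_comm 1 a t t', Stage.threadDist_comm 1 a (Stage.par true),
      key ht' ht ((false_iff ha ha' ht').1 h') ((true_iff ha ha' ht).1 h)]
    ring
  · exact absurd rfl hb


/-! ### Distances in a successor stage, near the anchors -/

namespace Stage

/-- `IsNew` records only width at most `1`; the estimates near the anchors need the sharper bound
from the choice of pairs. -/
theorem dist_ufoot_le_half {X : Stage} (hX : X.IsMetric) {e : RatEnum} {o : Orientation} {x : Pt}
    (hx : x ∈ (X.succ e o).carrier) (hn : x ∉ X.carrier) :
    X.dist (X.ufoot x false) (X.ufoot x true) ≤ 1 / 2 := by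
  obtain ⟨z, ⟨p, hp, q, hq, hz, hpos, hle⟩, γ, -, t, -, -, -, rfl⟩ := hx.resolve_left hn
  rw [ufoot_false hn, ufoot_true hn]
  have hs := o.spec z
  rw [hz, Sym2.eq_iff] at hs
  rw [hz]
  rcases hs with ⟨ha, hb⟩ | ⟨ha, hb⟩ <;> rw [ha, hb]
  · exact hle
  · rwa [hX.comm q hq.1 p hp]

/-- `b` is a closest anchor of `x`, at distance less than `1 / 8`. -/
def Near (X : Stage) (x : Pt) (b : Bool) : Prop :=
  X.uleg x b < 1 / 8 ∧ ∀ b', X.uleg x b ≤ X.uleg x b'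

theorem exists_near {X : Stage} {x : Pt} {b : Bool} (h : X.uleg x b < 1 / 8) :
    ∃ c, X.Near x c := by
  obtain ⟨c, hc⟩ := exists_min2 (X.uleg x)
  have hle : ∀ b', X.uleg x c ≤ X.uleg x b' := fun b' => hc ▸ min2_le _ b'
  exact ⟨c, (hle b).trans_lt h, hle⟩

/-- An old point counts as its own foot with leg `0`, so formulas for pairs of points near anchors
also cover old points. -/
theorem near_of_mem {X : Stage} {x : Pt} (h : x ∈ X.carrier) (b : Bool) : X.Near x b := by
  simp [Near, uleg, h]

/-- From a point close to one of its anchors, the shortest path to the other anchor goes through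
the close one. -/
theorem Near.uleg_eq_add {X : Stage} (hX : X.IsMetric) {e : RatEnum} {o : Orientation} {x : Pt}
    (hx : x ∈ (X.succ e o).carrier) {b : Bool} (hb : X.Near x b) (b' : Bool) :
    X.uleg x b' = X.uleg x b + X.dist (X.ufoot x b) (X.ufoot x b') := by
  have hv := valid_of_mem hX hx
  by_cases hn : x ∈ X.carrier
  · simp [uleg, ufoot, hn, hX.self x hn]
  have hh := dist_ufoot_le_half hX hx hn
  rw [dist_ufoot hX hv b b' hn]
  obtain ⟨-, p, q, γ, t, rfl, hp, hq, ha, ha1, ht, h0, h1⟩ := hv.resolve_left hn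
  rw [ufoot_false hn, ufoot_true hn] at *
  simp only [Near, uleg_eq _ hn] at *
  exact NearAnchor.threadDist_par hb ha hh ht b'

/-- Distances between points close to anchors are realized through these anchors. -/
theorem through_eq_add {X : Stage} (hX : X.IsMetric) {e : RatEnum} {o : Orientation} {x y : Pt}
    (hx : x ∈ (X.succ e o).carrier) (hy : y ∈ (X.succ e o).carrier) {b b' : Bool}
    (hb : X.Near x b) (hb' : X.Near y b') :
    X.through x y = X.uleg x b + X.dist (X.ufoot x b) (X.ufoot y b') + X.uleg y b' := by
  have hvx := valid_of_mem hX hx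
  have hvy := valid_of_mem hX hy
  refine le_antisymm (X.through_le x y b b') ?_
  obtain ⟨c, c', h⟩ := X.exists_through x y
  rw [h, hb.uleg_eq_add hX hx c, hb'.uleg_eq_add hX hy c',
    hX.comm _ (ufoot_mem hvy b') _ (ufoot_mem hvy c')]
  -- With both legs of the optimal path rerouted through the close anchors, only the triangle
  -- inequality between the four feet remains.
  have h1 := hX.tri _ (ufoot_mem hvx b) _ (ufoot_mem hvx c) _ (ufoot_mem hvy b')
  have h2 := hX.tri _ (ufoot_mem hvx c) _ (ufoot_mem hvy c') _ (ufoot_mem hvy b')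
  linarith

theorem not_sameThread_of_mem {X : Stage} {x y : Pt} (hy : y ∈ X.carrier) :
    ¬ X.SameThread x y := fun h => h.2.1 hy

/-- On a common thread, different feet mean opposite ends, where the shortest route is through both
anchors. With equal feet the formula can fail, since two points near one end may be joined directly.
-/
theorem attachDist_eq_add {X : Stage} (hX : X.IsMetric) {e : RatEnum} {o : Orientation} {x y : Pt}
    (hx : x ∈ (X.succ e o).carrier) (hy : y ∈ (X.succ e o).carrier) {b b' : Bool}
    (hb : X.Near x b) (hb' : X.Near y b')
    (hne : X.ufoot x b ≠ X.ufoot y b') :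
    X.attachDist x y = X.uleg x b + X.dist (X.ufoot x b) (X.ufoot y b') + X.uleg y b' := by
  have hvx := valid_of_mem hX hx
  have hvy := valid_of_mem hX hy
  by_cases hs : X.SameThread x y
  · obtain ⟨hn, hn', p, q, γ, t, t', rfl, rfl⟩ := hs
    have hh := dist_ufoot_le_half hX hx hn
    have hd := dist_ufoot hX hvx b b' hn
    have hfe : X.ufoot (Pt.thread p q γ t) b' = X.ufoot (Pt.thread p q γ t') b' := by
      simp [ufoot, hn, hn', foot]
    have hbb : b ≠ b' := fun h => hne (by rw [h, hfe])
    rw [attachDist_same hn hn', ← hfe, hd]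
    obtain ⟨-, _, _, _, _, e1, hp, hq, ha, ha1, ht, -⟩ := hvx.resolve_left hn
    obtain ⟨-, _, _, _, _, e2, -, -, -, -, ht', -⟩ := hvy.resolve_left hn'
    cases e1
    cases e2
    rw [ufoot_false hn, ufoot_true hn] at *
    simp only [Near, uleg_eq _ hn, uleg_eq _ hn'] at *
    exact NearAnchor.threadDist_eq hb hb' hbb ha hh ht ht'
  · rw [attachDist_through hX hvx hvy hs, through_eq_add hX hx hy hb hb']

theorem attachDist_old {X : Stage} (hX : X.IsMetric) {e : RatEnum} {o : Orientation} {x y : Pt}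
    (hx : x ∈ (X.succ e o).carrier) (hy : y ∈ X.carrier) {b : Bool}
    (hb : X.Near x b) :
    X.attachDist x y = X.uleg x b + X.dist (X.ufoot x b) y := by
  have hy' : y ∈ (X.succ e o).carrier := Or.inl hy
  have hl : X.uleg y false = 0 := by simp [uleg, hy]
  have hf : X.ufoot y false = y := by simp [ufoot, hy]
  rw [attachDist_through hX (valid_of_mem hX hx) (valid_of_mem hX hy') (not_sameThread_of_mem hy),
    through_eq_add hX hx hy' hb (near_of_mem hy false), hl, hf, add_zero]

/-- A path to a point off the thread must pass through an anchor. This locates points close to an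
older skein, and it also confines certain Cauchy sequences to a single thread. -/
theorem exists_uleg_le {X : Stage} (hX : X.IsMetric) {e : RatEnum} {o : Orientation} {x y : Pt}
    (hx : x ∈ (X.succ e o).carrier) (hy : y ∈ (X.succ e o).carrier)
    (hs : ¬ X.SameThread x y) : ∃ b, X.uleg x b ≤ X.attachDist x y := by
  have hvx := valid_of_mem hX hx
  have hvy := valid_of_mem hX hy
  obtain ⟨b, b', h⟩ := X.exists_through x y
  refine ⟨b, ?_⟩
  rw [attachDist_through hX hvx hvy hs, h]
  linarith [uleg_nonneg hvy b', hX.nonneg (ufoot_mem hvx b) (ufoot_mem hvy b')]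

theorem attachDist_ufoot_le {X : Stage} (hX : X.IsMetric) {e : RatEnum} {o : Orientation} {x : Pt}
    (hx : x ∈ (X.succ e o).carrier) (b : Bool) : X.attachDist x (X.ufoot x b) ≤ X.uleg x b := by
  have hvx := valid_of_mem hX hx
  have hy := ufoot_mem hvx b
  have hl : X.uleg (X.ufoot x b) false = 0 := by simp [uleg, hy]
  have hf : X.ufoot (X.ufoot x b) false = X.ufoot x b := by
    simp only [ufoot.eq_1 X (X.ufoot x b), hy, if_true]
  rw [attachDist_through hX hvx (Or.inl hy) (not_sameThread_of_mem hy)]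
  refine (X.through_le _ _ b false).trans ?_
  rw [hl, hf, hX.self _ hy]
  simp

end Stage

/-! ### Closedness of threads and convergence of parameters -/

theorem isClosed_threadSet (e : RatEnum) (γ : ℕ → ℝ) : IsClosed (threadSet e γ) :=
  isClosed_Icc.sdiff (isOpen_iUnion fun _ => isOpen_Ioo)

theorem threadDist_le_abs (l a x y : ℝ) : threadDist l a x y ≤ |x - y| := min_le_left _ _

/-- Both routes through the ends cost at least `a`, so below `a` the distance is that of the
parameters. -/
theorem abs_sub_le_of_threadDist_lt {a x y : ℝ} (hx : x ∈ Icc (0 : ℝ) 1) (hy : y ∈ Icc (0 : ℝ) 1)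
    (h : threadDist 1 a x y < a) : |x - y| ≤ threadDist 1 a x y := by
  obtain ⟨hx0, hx1⟩ := hx
  obtain ⟨hy0, hy1⟩ := hy
  simp only [threadDist] at *
  grind

/-! ### The skeins as subspaces of the last one -/

section SkIn

variable {e : RatEnum} {o : Orientation}

theorem dist_eq_stage {α : Ordinal.{0}} (hα : α ≤ ω₁) {x y : Sk e o ω₁} (hx : x ∈ SkIn e o α)
    (hy : y ∈ SkIn e o α) : dist x y = (stage e o α).dist x.1 y.1 :=
  ((stage_invariant e o ω₁).2 α hα).dist_eq x.1 hx y.1 hy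

theorem SkIn_mono {α β : Ordinal.{0}} (h : α ≤ β) : SkIn e o α ⊆ SkIn e o β :=
  fun _ hx => ((stage_invariant e o β).2 α h).sub hx

theorem exists_SkIn {α : Ordinal.{0}} (hα : α ≤ ω₁) {x : Pt} (hx : x ∈ (stage e o α).carrier) :
    ∃ y ∈ SkIn e o α, y.1 = x :=
  ⟨⟨x, ((stage_invariant e o ω₁).2 α hα).sub hx⟩, hx, rfl⟩

theorem mem_SkIn_add_one {α : Ordinal.{0}} {x : Sk e o ω₁} :
    x ∈ SkIn e o (α + 1) ↔ x.1 ∈ ((stage e o α).succ e o).carrier := by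
  rw [← stage_add_one]
  rfl

theorem dist_eq_attachDist {α : Ordinal.{0}} (hα : α + 1 ≤ ω₁) {x y : Sk e o ω₁}
    (hx : x ∈ SkIn e o (α + 1)) (hy : y ∈ SkIn e o (α + 1)) :
    dist x y = (stage e o α).attachDist x.1 y.1 := by
  rw [dist_eq_stage hα hx hy, stage_add_one]
  rfl

/-! ### Gates -/

/-- A point whose closest anchor is `u` has the same gates as `u`. -/
theorem isGate_anchor {α β : Ordinal.{0}} (hβ : β ≤ α) (hα : α + 1 ≤ ω₁) {p u x : Sk e o ω₁}
    (hp : p ∈ SkIn e o (α + 1)) {b : Bool} (hb : (stage e o α).Near p.1 b)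
    (hu : u.1 = (stage e o α).ufoot p.1 b) : IsGate (SkIn e o β) p x ↔ IsGate (SkIn e o β) u x := by
  have hm := (stage_invariant e o α).1
  have hα' : α ≤ ω₁ := le_self_add.trans hα
  have hp' := mem_SkIn_add_one.1 hp
  have huα : u ∈ SkIn e o α := by
    change u.1 ∈ (stage e o α).carrier
    rw [hu]
    exact Stage.ufoot_mem (Stage.valid_of_mem hm hp') b
  -- The functions `d(p,·)` and `d(u,·)` differ on `Sk(β)` by the constant leg, which cancels in the
  -- gate identity.
  have key : ∀ y ∈ SkIn e o β, dist p y = (stage e o α).uleg p.1 b + dist u y := by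
    intro y hy
    have hy' : y ∈ SkIn e o α := SkIn_mono hβ hy
    rw [dist_eq_attachDist hα hp (SkIn_mono le_self_add hy'), dist_eq_stage hα' huα hy', hu]
    exact Stage.attachDist_old hm hp' hy' hb
  refine and_congr_right fun hx => forall₂_congr fun y hy => ?_
  rw [key y hy, key x hx, add_assoc, add_right_inj]

theorem exists_near_anchor {α β : Ordinal.{0}} (hβ : β ≤ α) (hα : α + 1 ≤ ω₁) {p y : Sk e o ω₁}
    (hp : p ∈ SkIn e o (α + 1)) (hy : y ∈ SkIn e o β) (hd : dist p y < 1 / 8) :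
    ∃ b, (stage e o α).Near p.1 b ∧ ∃ u ∈ SkIn e o α, u.1 = (stage e o α).ufoot p.1 b ∧
      dist p y = (stage e o α).uleg p.1 b + dist u y := by
  have hm := (stage_invariant e o α).1
  have hα' : α ≤ ω₁ := le_self_add.trans hα
  have hp' := mem_SkIn_add_one.1 hp
  have hy' : y ∈ SkIn e o α := SkIn_mono hβ hy
  have hy1 : y ∈ SkIn e o (α + 1) := SkIn_mono le_self_add hy'
  obtain ⟨c, hc⟩ := Stage.exists_uleg_le hm hp' (mem_SkIn_add_one.1 hy1)
    (Stage.not_sameThread_of_mem hy')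
  rw [← dist_eq_attachDist hα hp hy1] at hc
  obtain ⟨b, hb⟩ := Stage.exists_near (hc.trans_lt hd)
  obtain ⟨u, hu, hub⟩ := exists_SkIn hα' (Stage.ufoot_mem (Stage.valid_of_mem hm hp') b)
  refine ⟨b, hb, u, hu, hub, ?_⟩
  rw [dist_eq_attachDist hα hp hy1, dist_eq_stage hα' hu hy', hub]
  exact Stage.attachDist_old hm hp' hy' hb

/-- Both properties are transported from the close anchors `u`, `v`: they have the same gates as
`p`, `q`, and moving to them only shortens the distances to `Sk(β)`. -/
theorem isGated_add_one {α β : Ordinal.{0}} (hβ : β ≤ α) (hα : α + 1 ≤ ω₁)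
    (h : IsGated (1 / 8) (SkIn e o β) (SkIn e o α)) :
    IsGated (1 / 8) (SkIn e o β) (SkIn e o (α + 1)) where
  exists_gate p hp y hy hd := by
    have hm := (stage_invariant e o α).1
    obtain ⟨b, hb, u, hu, hub, hpu⟩ := exists_near_anchor hβ hα hp hy hd
    have hl := Stage.uleg_nonneg (Stage.valid_of_mem hm (mem_SkIn_add_one.1 hp)) b
    obtain ⟨x, hx⟩ := h.exists_gate u hu y hy (by linarith)
    exact ⟨x, (isGate_anchor hβ hα hp hb hub).2 hx⟩
  dist_eq p hp q hq x y hx hy hpx hqy hxy := by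
    have hm := (stage_invariant e o α).1
    have hα' : α ≤ ω₁ := le_self_add.trans hα
    have hp' := mem_SkIn_add_one.1 hp
    have hq' := mem_SkIn_add_one.1 hq
    obtain ⟨b, hb, u, hu, hub, hpu⟩ := exists_near_anchor hβ hα hp hx.1 hpx
    obtain ⟨c, hc, v, hv, hvc, hqv⟩ := exists_near_anchor hβ hα hq hy.1 hqy
    have hl := Stage.uleg_nonneg (Stage.valid_of_mem hm hp') b
    have hl' := Stage.uleg_nonneg (Stage.valid_of_mem hm hq') c
    have hux := (isGate_anchor hβ hα hp hb hub).1 hx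
    have hvy := (isGate_anchor hβ hα hq hc hvc).1 hy
    have huv := h.dist_eq u hu v hv x y hux hvy (by linarith) (by linarith) hxy
    -- Equal anchors would make the left side of `huv` zero, while the right side is at least
    -- `d(x,y) > 0`.
    have hne : (stage e o α).ufoot p.1 b ≠ (stage e o α).ufoot q.1 c := by
      rw [← hub, ← hvc]
      intro he
      have he' : u = v := Subtype.ext he
      rw [he', dist_self] at huv
      linarith [dist_pos.2 hxy, dist_nonneg (x := v) (y := x), dist_nonneg (x := y) (y := v)]
    rw [dist_eq_attachDist hα hp hq, Stage.attachDist_eq_add hm hp' hq' hb hc hne, ← hub, ← hvc,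
      ← dist_eq_stage hα' hu hv, huv, hpu, dist_comm y q, hqv, dist_comm y v]
    ring

/-! ### Completeness -/

theorem isComplete_SkIn_zero : IsComplete (SkIn e o 0) := by
  refine Set.Finite.isCompact ?_ |>.isComplete
  refine Set.Finite.of_finite_image (f := Subtype.val) ?_ Subtype.val_injective.injOn
  refine (Set.finite_range Pt.base).subset ?_
  rintro _ ⟨x, hx, rfl⟩
  change x.1 ∈ (stage e o 0).carrier at hx
  rwa [stage_zero] at hx

theorem SkIn_subset_closure {κ : Ordinal.{0}} (hκ : Order.IsSuccLimit κ) (hκ' : κ ≤ ω₁) :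
    SkIn e o κ ⊆ closure (⋃ α : Iio κ, SkIn e o α.1) := by
  intro x hx
  have hx' : x.1 ∈ (stage e o κ).carrier := hx
  rw [stage_limit e o hκ] at hx'
  rcases hx' with h | ⟨s, ⟨c, rfl⟩, hs⟩
  · obtain ⟨α, hα⟩ := mem_iUnion.1 h
    exact subset_closure (mem_iUnion.2 ⟨α, hα⟩)
  · have hl := lim_mem e o κ (s := c.out.1) (by rw [hs]; exact hx)
    rw [hs] at hl
    choose u hu hus using fun n => exists_SkIn hκ' (hl.1 n)
    refine mem_closure_of_tendsto (f := u) (b := atTop) ?_ (Eventually.of_forall fun n => ?_)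
    · rw [tendsto_iff_dist_tendsto_zero]
      refine hl.2.congr fun n => ?_
      rw [dist_eq_stage hκ' (hu n) hx, hus n]
    · obtain ⟨α, hα⟩ := mem_iUnion.1 (c.out.2.mem n)
      refine mem_iUnion.2 ⟨α, ?_⟩
      rw [← hus n] at hα
      exact hα

/-- `Quot` identifies sequences only up to the generated equivalence; here the relation is already
an equivalence. -/
theorem Stage.tendsto_of_eqvGen {X : Stage} (hX : X.IsMetric)
    {s t : {s : ℕ → Pt // X.IsFreeCauchy s}}
    (h : Relation.EqvGen (fun s t : {s : ℕ → Pt // X.IsFreeCauchy s} =>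
      Tendsto (fun n => X.dist (s.1 n) (t.1 n)) atTop (𝓝 0)) s t) :
    Tendsto (fun n => X.dist (s.1 n) (t.1 n)) atTop (𝓝 0) := by
  induction h with
  | rel _ _ h => exact h
  | refl s =>
    refine tendsto_const_nhds.congr fun n => ?_
    exact (hX.self _ (s.2.mem n)).symm
  | symm s t _ h =>
    refine h.congr fun n => ?_
    exact hX.comm _ (s.2.mem n) _ (t.2.mem n)
  | trans s t r _ _ h h' =>
    refine squeeze_zero (fun n => hX.nonneg (s.2.mem n) (r.2.mem n)) (fun n =>
      hX.tri _ (s.2.mem n) _ (t.2.mem n) _ (r.2.mem n)) ?_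
    simpa using h.add h'

/-- By density it suffices to treat Cauchy sequences in the union. One without a limit there is
equivalent to its chosen representative, whose ideal limit is a point of the skein. -/
theorem isComplete_SkIn_limit {κ : Ordinal.{0}} (hκ : Order.IsSuccLimit κ) (hκ' : κ ≤ ω₁) :
    IsComplete (SkIn e o κ) := by
  refine isComplete_of_cauchySeq fun w hw hwc =>
    exists_tendsto_of_frequently_near (D := ⋃ α : Iio κ, SkIn e o α.1) ?_ hwc fun ε hε N =>
      ⟨N, le_rfl, Metric.mem_closure_iff.1 (SkIn_subset_closure hκ hκ' (hw N)) ε hε⟩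
  intro v hv hc
  have hm : (Stage.union fun α : Iio κ => stage e o α.1).IsMetric :=
    Stage.union_isMetric (fun i j hij => (stage_invariant e o j.1).2 i.1 hij)
      fun i => (stage_invariant e o i.1).1
  have hE := Stage.completion_extends hm
  rw [← stage_limit e o hκ] at hE
  have hR : Pt.lim '' (Stage.union fun α : Iio κ => stage e o α.1).limitReps ⊆
      (stage e o κ).carrier := by
    rw [stage_limit e o hκ]
    exact subset_union_right
  generalize hX : (Stage.union fun α : Iio κ => stage e o α.1) = X at *
  have hmem : ∀ x : Sk e o ω₁, x ∈ ⋃ α : Iio κ, SkIn e o α.1 ↔ x.1 ∈ X.carrier := by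
    intro x
    rw [← hX]
    simp [SkIn, Stage.union]
  have hsub : ∀ x : Sk e o ω₁, x.1 ∈ X.carrier → x ∈ SkIn e o κ := fun x hx => hE.sub hx
  have hdist : ∀ x y : Sk e o ω₁, x.1 ∈ X.carrier → y.1 ∈ X.carrier →
      dist x y = X.dist x.1 y.1 := by
    intro x y hx hy
    rw [dist_eq_stage hκ' (hsub x hx) (hsub y hy), hE.dist_eq _ hx _ hy]
  have hvX : ∀ n, (v n).1 ∈ X.carrier := fun n => (hmem _).1 (hv n)
  by_cases hfree : ∃ x ∈ X.carrier, Tendsto (fun n => X.dist (v n).1 x) atTop (𝓝 0)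
  · obtain ⟨x, hx, hlim⟩ := hfree
    obtain ⟨y, hy, rfl⟩ := exists_SkIn hκ' (hE.sub hx)
    refine ⟨y, hy, tendsto_iff_dist_tendsto_zero.2 (hlim.congr fun n => ?_)⟩
    rw [hdist _ _ (hvX n) hx]
  · have hf : X.IsFreeCauchy fun n => (v n).1 := by
      refine ⟨hvX, fun ε hε => ?_, hfree⟩
      obtain ⟨N, hN⟩ := Metric.cauchySeq_iff.1 hc ε hε
      refine ⟨N, fun m hm n hn => ?_⟩
      rw [← hdist _ _ (hvX m) (hvX n)]
      exact hN m hm n hn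
    let c : Quot (fun s t : {s : ℕ → Pt // X.IsFreeCauchy s} =>
      Tendsto (fun n => X.dist (s.1 n) (t.1 n)) atTop (𝓝 0)) := Quot.mk _ ⟨_, hf⟩
    have hcv : Tendsto (fun n => X.dist (v n).1 (c.out.1 n)) atTop (𝓝 0) :=
      Stage.tendsto_of_eqvGen hm (s := ⟨_, hf⟩) (Quot.eqvGen_exact c.out_eq.symm)
    have hlm : Pt.lim c.out.1 ∈ (stage e o κ).carrier := hR ⟨_, ⟨c, rfl⟩, rfl⟩
    obtain ⟨y, hy, hyc⟩ := exists_SkIn hκ' hlm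
    have hl := (lim_mem e o κ hlm).2
    refine ⟨y, hy, tendsto_iff_dist_tendsto_zero.2 ?_⟩
    have hadd := hcv.add hl
    rw [add_zero] at hadd
    refine squeeze_zero (fun _ => dist_nonneg) (fun n => ?_) hadd
    rw [dist_eq_stage hκ' (hsub _ (hvX n)) hy, hyc,
      ← hE.dist_eq _ (hvX n) _ (c.out.2.mem n)]
    exact (stage_invariant e o κ).1.tri _ (hsub _ (hvX n)) _ (hE.sub (c.out.2.mem n)) _ hlm

/-- A Cauchy sequence that keeps approaching `Sk(α)` converges there. Otherwise a tail stays at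
distance at least `ε` from all anchors, so it cannot change threads, and its parameters converge in
the closed set `T_γ` to an interior parameter. -/
theorem isComplete_SkIn_add_one {α : Ordinal.{0}} (hα : α + 1 ≤ ω₁)
    (h : IsComplete (SkIn e o α)) : IsComplete (SkIn e o (α + 1)) := by
  have hm := (stage_invariant e o α).1
  have hα' : α ≤ ω₁ := le_self_add.trans hα
  have hsub : SkIn e o α ⊆ SkIn e o (α + 1) := SkIn_mono le_self_add
  refine isComplete_of_cauchySeq fun u hu hc => ?_
  by_cases hnear : ∀ ε > 0, ∀ N, ∃ n ≥ N, ∃ y ∈ SkIn e o α, dist (u n) y < ε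
  · refine exists_tendsto_of_frequently_near (D := SkIn e o α) (fun v hv hvc => ?_) hc hnear
    obtain ⟨x, hx, hlim⟩ := cauchySeq_tendsto_of_isComplete h hv hvc
    exact ⟨x, hsub hx, hlim⟩
  push Not at hnear
  obtain ⟨ε, hε, N, hN⟩ := hnear
  obtain ⟨N', hN'⟩ := Metric.cauchySeq_iff.1 hc ε hε
  have hfar : ∀ n ≥ N, ∀ x ∈ (stage e o α).carrier, ε ≤ (stage e o α).attachDist (u n).1 x := by
    intro n hn x hx
    obtain ⟨y, hy, rfl⟩ := exists_SkIn hα' hx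
    rw [← dist_eq_attachDist hα (hu n) (hsub hy)]
    exact hN n hn y hy
  -- Changing threads costs at least the leg to some anchor, hence at least `ε`, but tail terms are
  -- closer than `ε`.
  have hsame : ∀ n, (stage e o α).SameThread (u (max N N')).1 (u (n + max N N')).1 := by
    intro n
    by_contra hs
    have h0 := mem_SkIn_add_one.1 (hu (max N N'))
    obtain ⟨b, hb⟩ := Stage.exists_uleg_le hm h0 (mem_SkIn_add_one.1 (hu _)) hs
    have h1 := hfar _ (le_max_left N N') _ (Stage.ufoot_mem (Stage.valid_of_mem hm h0) b)
    have h2 := Stage.attachDist_ufoot_le hm h0 b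
    have h3 := hN' (max N N') (le_max_right N N') (n + max N N')
      ((le_max_right N N').trans (Nat.le_add_left _ _))
    rw [dist_eq_attachDist hα (hu _) (hu _)] at h3
    linarith
  have hu0 := mem_SkIn_add_one.1 (hu (max N N'))
  have hn0 := (hsame 0).1
  obtain ⟨z, hz, γ, hγ, t₀, ht₀, ht₀0, ht₀1, heq⟩ := hu0.resolve_left hn0
  -- The anchors become variables so that `cases` can solve equations with labels whose anchors are
  -- again values of `o.toFun`.
  obtain ⟨p, hp⟩ : ∃ p, p = (o.toFun z).1 := ⟨_, rfl⟩
  obtain ⟨q, hq⟩ : ∃ q, q = (o.toFun z).2 := ⟨_, rfl⟩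
  rw [← hp, ← hq] at heq
  obtain ⟨_, _, _, _, heq', hpα, hqα, ha, -, -⟩ := Stage.isNew_of_mem hm (hu0.resolve_left hn0)
  rw [heq] at heq'
  cases heq'
  have hthread : ∀ n, ∃ t, (u (n + max N N')).1 = Pt.thread p q γ t ∧ t ∈ threadSet e γ := by
    intro n
    obtain ⟨-, hn, p', q', γ', t, t', h1, h2⟩ := hsame n
    rw [heq] at h1
    cases h1
    refine ⟨t', h2, ?_⟩
    obtain ⟨z', -, γ', -, t'', ht'', -, -, h3⟩ := (mem_SkIn_add_one.1 (hu _)).resolve_left hn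
    rw [h2] at h3
    cases h3
    exact ht''
  choose t ht htm using hthread
  generalize hK : max N N' = K at *
  have hnew : ∀ n, Pt.thread p q γ (t n) ∉ (stage e o α).carrier := fun n => by
    rw [← ht n]
    exact (hsame n).2.1
  have hcK : CauchySeq fun n => u (n + K) := hc.comp_tendsto (tendsto_add_atTop_nat K)
  have htc : CauchySeq t := by
    rw [Metric.cauchySeq_iff]
    intro δ hδ
    -- The bound `a`, the width of the thread, excludes the shortcut through the ends; `δ` gives the
    -- required precision.
    obtain ⟨m, hm'⟩ := Metric.cauchySeq_iff.1 hcK _ (lt_min hδ ha)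
    refine ⟨m, fun i hi j hj => ?_⟩
    have h1 := hm' i hi j hj
    rw [dist_eq_attachDist hα (hu _) (hu _), ht, ht, Stage.attachDist_same (hnew i) (hnew j)] at h1
    rw [Real.dist_eq]
    exact (abs_sub_le_of_threadDist_lt (htm i).1 (htm j).1
      (h1.trans_le (min_le_right _ _))).trans_lt (h1.trans_le (min_le_left _ _))
  obtain ⟨τ, hτ⟩ := cauchySeq_tendsto_of_complete htc
  have hτm : τ ∈ threadSet e γ :=
    (isClosed_threadSet e γ).mem_of_tendsto hτ (Eventually.of_forall htm)
  -- The distance from the anchors passes to the limit, so `τ` is neither `0` nor `1` and labels a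
  -- genuine new point.
  have hpar : ∀ b, ε ≤ |τ - Stage.par b| := by
    intro b
    refine ge_of_tendsto (hτ.sub_const _).abs (Eventually.of_forall fun n => ?_)
    have h1 := mem_SkIn_add_one.1 (hu (n + K))
    have h2 := hfar (n + K) (by rw [← hK]; exact (le_max_left N N').trans (Nat.le_add_left _ _)) _
      (Stage.ufoot_mem (Stage.valid_of_mem hm h1) b)
    refine (h2.trans (Stage.attachDist_ufoot_le hm h1 b)).trans ?_
    rw [ht, Stage.uleg_eq _ (hnew n)]
    exact threadDist_le_abs _ _ _ _
  have hτ0 : τ ≠ 0 := by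
    rintro rfl
    have := hpar false
    simp only [Stage.par, Bool.false_eq_true, if_false, sub_zero, abs_zero] at this
    linarith
  have hτ1 : τ ≠ 1 := by
    rintro rfl
    have := hpar true
    simp only [Stage.par, if_true, sub_self, abs_zero] at this
    linarith
  have hxn : Pt.thread p q γ τ ∈ (stage e o α).newPts e o :=
    ⟨z, hz, γ, hγ, τ, hτm, hτ0, hτ1, by rw [hp, hq]⟩
  have hx : Pt.thread p q γ τ ∈ (stage e o (α + 1)).carrier := by
    rw [stage_add_one]
    exact Or.inr hxn
  obtain ⟨x, hxα, hxτ⟩ := exists_SkIn hα hx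
  refine ⟨x, hxα, (tendsto_add_atTop_iff_nat K).1 (tendsto_iff_dist_tendsto_zero.2 ?_)⟩
  refine squeeze_zero (fun _ => dist_nonneg) (fun n => ?_) (tendsto_iff_dist_tendsto_zero.1 hτ)
  rw [dist_eq_attachDist hα (hu _) hxα, ht, hxτ,
    Stage.attachDist_same (hnew n) (Set.disjoint_left.1 (newPts_disjoint e o α) hxn)]
  exact threadDist_le_abs _ _ _ _

/-! ### The two transfinite inductions -/

theorem isComplete_SkIn {α : Ordinal.{0}} (hα : α ≤ ω₁) : IsComplete (SkIn e o α) := by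
  induction α using Ordinal.limitRecOn with
  | zero => exact isComplete_SkIn_zero
  | add_one α ih => exact isComplete_SkIn_add_one hα (ih (le_self_add.trans hα))
  | limit κ hκ ih => exact isComplete_SkIn_limit hκ hα

theorem isGated_SkIn {α β : Ordinal.{0}} (hβ : β ≤ α) (hα : α ≤ ω₁) :
    IsGated (1 / 8) (SkIn e o β) (SkIn e o α) := by
  induction α using Ordinal.limitRecOn with
  | zero =>
    rw [nonpos_iff_eq_zero.1 hβ]
    exact isGated_self _ _
  | add_one α ih =>
    rcases hβ.lt_or_eq with h | rfl
    · have h' := Order.lt_add_one_iff.1 h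
      exact isGated_add_one h' hα (ih h' (le_self_add.trans hα))
    · exact isGated_self _ _
  | limit κ hκ ih =>
    rcases hβ.lt_or_eq with h | rfl
    · refine IsGated.mono (IsGated.closure (isComplete_SkIn (h.le.trans hα)) ?_)
        (SkIn_subset_closure hκ hα)
      refine IsGated.iUnion (fun i j hij => SkIn_mono hij) fun i => ?_
      -- The induction hypothesis is available only from `β` on, so earlier skeins are absorbed into
      -- the one at `max i β`.
      refine IsGated.mono (ih (max i.1 β) (max_lt i.2 h) (le_max_right _ _)
        ((max_lt i.2 h).le.trans hα)) (SkIn_mono (le_max_left _ _))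
    · exact isGated_self _ _

/-! ### From gates to nearest points -/

theorem mem_SkIn_omega_one (p : Sk e o ω₁) : p ∈ SkIn e o ω₁ := p.2

theorem IsGate.ancestors_eq {β : Ordinal.{0}} {p x : Sk e o ω₁} (h : IsGate (SkIn e o β) p x) :
    ancestors e o β p = {x} := by
  ext y
  refine ⟨fun hy => h.eq_of_dist_eq_infDist hy.1 hy.2, ?_⟩
  rintro rfl
  exact ⟨h.1, h.infDist_eq.symm⟩

theorem exists_gate_of_mem_ball {β : Ordinal.{0}} (hβ : β ≤ ω₁) {p : Sk e o ω₁}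
    (hp : p ∈ ball e o β) : ∃ x, IsGate (SkIn e o β) p x ∧ dist p x < 1 / 8 := by
  obtain ⟨y, hy, hd⟩ := Metric.mem_thickening_iff.1 hp
  obtain ⟨x, hx⟩ := (isGated_SkIn hβ le_rfl).exists_gate p (mem_SkIn_omega_one p) y hy hd
  exact ⟨x, hx, (hx.dist_le hy).trans_lt hd⟩

end SkIn

end Skein

end

theorem mainTheorem3 (e : Skein.RatEnum) (o : Skein.Orientation) (β : Ordinal.{0})
    (hβ : β < ω₁) :
    -- every point of the ball has a unique nearest point in `Sk(β)`
    (∀ p ∈ Skein.ball e o β, ∃! x, x ∈ Skein.ancestors e o β p) ∧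
    -- the distance formula for points with different nearest points
    (∀ p ∈ Skein.ball e o β, ∀ q ∈ Skein.ball e o β,
      ∀ x ∈ Skein.ancestors e o β p, ∀ y ∈ Skein.ancestors e o β q,
        x ≠ y → dist p q = dist p x + dist x y + dist y q) ∧
    -- the nearest point map is a `1`-Lipschitz retraction
    Skein.IsStable e o β (Skein.ball e o β) ∧
    -- `Sk(β)` is a `1`-Lipschitz retract of the ball
    ∃ R : Skein.ball e o β → Skein.Sk e o ω₁,
      Skein.IsLipschitzRetraction 1 (Skein.ball e o β) (Skein.SkIn e o β) R := by
  have hgate : ∀ p : Skein.Sk e o ω₁, ∃ x, p ∈ Skein.ball e o β →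
      Skein.IsGate (Skein.SkIn e o β) p x ∧ dist p x < 1 / 8 := fun p => by
    by_cases hp : p ∈ Skein.ball e o β
    · obtain ⟨x, hx⟩ := Skein.exists_gate_of_mem_ball hβ.le hp
      exact ⟨x, fun _ => hx⟩
    -- Outside the ball the value is a dummy; it lets `choose` produce a map on the whole space.
    · exact ⟨p, fun h => absurd h hp⟩
  have hG := Skein.isGated_SkIn (e := e) (o := o) hβ.le le_rfl
  choose R hRd using hgate
  have hR := fun p hp => (hRd p hp).1
  have hd := fun p hp => (hRd p hp).2
  have hstable : Skein.IsLipschitzRetraction 1 (Skein.ball e o β) (Skein.SkIn e o β)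
      fun p => R p.1 :=
    { subset := Metric.self_subset_thickening (by norm_num) _
      maps := fun p => (hR p.1 p.2).1
      fix := fun p hp => (hR p.1 p.2).eq_of_mem hp
      lipschitz := LipschitzWith.mk_one fun p q => (hR p.1 p.2).dist_gate_le (hR q.1 q.2) }
  refine ⟨fun p hp => ?_, fun p hp q hq x hx y hy hxy => ?_, ?_, _, hstable⟩
  · rw [(hR p hp).ancestors_eq]
    exact ⟨R p, rfl, fun y hy => hy⟩
  · rw [(hR p hp).ancestors_eq, Set.mem_singleton_iff] at hx
    rw [(hR q hq).ancestors_eq, Set.mem_singleton_iff] at hy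
    subst hx hy
    exact hG.dist_eq p (Skein.mem_SkIn_omega_one p) q (Skein.mem_SkIn_omega_one q) _ _
      (hR p hp) (hR q hq) (hd p hp) (hd q hq) hxy
  · exact ⟨hstable.subset, _, fun p => (hR p.1 p.2).ancestors_eq, hstable⟩
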